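/- Let $\Gamma$ be a finitely generated group and set $n=\dim_{\mathbb C} H_1(\Gamma,\mathbb{C})$. Let $A(\Gamma)$ be the (possibly non-reduced) ring of regular functions on the representation variety $\operatorname{Hom}(\Gamma,\mathrm{SL}_2(\mathbb{C}))$, i.e. the commutative $\mathbb{C}$-algebra representing the functor $B\mapsto\operatorname{Hom}(\Gamma,\mathrm{SL}_2(B))$. Let $X(\Gamma)=\operatorname{Spec} A(\Gamma)^{\mathrm{SL}_2(\mathbb{C})}$ be the character variety, where $\mathrm{SL}_2(\mathbb{C})$ acts by conjugation, and let $\chi\in X(\Gamma)$ be the trivial character, i.e. the point whose maximal ideal $m\subset A(\Gamma)^{\mathrm{SL}_2(\mathbb{C})}$ consists of the invariant functions vanishing at the trivial representation. The Zariski tangent space is $T_\chi X(\Gamma)=(m/m^2)^*$; the local dimension $\dim_\chi X(\Gamma)$ is the infimum of the Krull dimensions of the Zariski-open neighbourhoods of $\chi$; and $X(\Gamma)$ is called smooth at $\chi$ if $\dim_\chi X(\Gamma)=\dim_{\mathbb C} T_\chi X(\Gamma)$. Then: 1. If $n<2$, then $X(\Gamma)$ is smooth at $\chi$. 2. If $n>2$,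 then $X(\Gamma)$ is not smooth at $\chi$. Moreover, in this case every nondegenerate quadratic form $q$ on $H_1(\Gamma,\mathbb{C})$ is an obstructed tangent vector at $\chi$: writing $u_\gamma=\operatorname{Tr}\rho(\gamma)-2\in m$ for $\gamma\in\Gamma$ and $[\gamma]\in H_1(\Gamma,\mathbb C)$ for the class of $\gamma$, there is a $v\in T_\chi X(\Gamma)$ with $v(u_\gamma)=q([\gamma])$ for all $\gamma\in\Gamma$, and there is no $\mathbb{C}$-algebra morphism $F\colon A(\Gamma)^{\mathrm{SL}_2(\mathbb{C})}\to\mathbb{C}[[t]]$ such that $F(x)\equiv t\,v(x) \pmod{t^2}$ for all $x\in m$. -/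

import Mathlib

open scoped MatrixGroups

noncomputable section

namespace CharVar

/-! ### Complex points of affine schemes: tangent space, local dimension, smoothness -/

/-- The dimension of a topological space at a point: the infimum of the Krull dimensions
(suprema of lengths of chains of irreducible closed subsets) of its open neighbourhoods. -/
def localDim {X : Type*} [TopologicalSpace X] (x : X) : WithBot ℕ∞ :=
  ⨅ (U : TopologicalSpace.Opens X) (_ : x ∈ U), topologicalKrullDim U

section Points

variable {R : Type*} [CommRing R] [Algebra ℂ R]

/-- The maximal ideal of functions vanishing at a complex point `ε` of `Spec R`. -/
abbrev pointIdeal (ε : R →ₐ[ℂ] ℂ) : Ideal R := RingHom.ker ε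

/-- A complex point `ε` of `Spec R` as a point of the underlying Zariski topological space. -/
def toSpec (ε : R →ₐ[ℂ] ℂ) : PrimeSpectrum R := ⟨pointIdeal ε, RingHom.ker_isPrime ε⟩

/-- The Zariski tangent space at `ε`: the dual of `m / m ^ 2`. -/
abbrev TangentSpace (ε : R →ₐ[ℂ] ℂ) : Type _ := Module.Dual ℂ (pointIdeal ε).Cotangent

/-- `Spec R` is smooth at `ε` if its dimension at `ε` is that of the Zariski tangent space. -/
def IsSmoothAt (ε : R →ₐ[ℂ] ℂ) : Prop :=
  localDim (toSpec ε) = ((Module.rank ℂ (TangentSpace ε)).toENat : WithBot ℕ∞)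

/-- A tangent vector `v` is unobstructed if it is the first order part of a formal deformation
of `ε`, i.e. of an algebra morphism `F : R → ℂ⟦t⟧` with `F x = v x * t + O(t ^ 2)` for all
`x` in the maximal ideal of `ε`. -/
def IsUnobstructed {ε : R →ₐ[ℂ] ℂ} (v : TangentSpace ε) : Prop :=
  ∃ F : R →ₐ[ℂ] PowerSeries ℂ, ∀ x : pointIdeal ε,
    PowerSeries.coeff 0 (F x) = 0 ∧
      PowerSeries.coeff 1 (F x) = v ((pointIdeal ε).toCotangent x)

end Points

/-! ### The representation variety and the character variety -/

section Representations

variable (Γ : Type*) [Group Γ]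

/-- The matrix of indeterminates attached to a group element. -/
def genMat (γ : Γ) : Matrix (Fin 2) (Fin 2) (MvPolynomial (Γ × Fin 2 × Fin 2) ℂ) :=
  Matrix.of fun i j => MvPolynomial.X (γ, i, j)

/-- The relations saying that the matrices of indeterminates have determinant `1` and multiply
as the group elements do. -/
def repIdeal : Ideal (MvPolynomial (Γ × Fin 2 × Fin 2) ℂ) :=
  Ideal.span
    (Set.range (fun γ : Γ => (genMat Γ γ).det - 1) ∪
      Set.range (fun p : Γ × Γ × Fin 2 × Fin 2 =>
        (genMat Γ (p.1 * p.2.1) - genMat Γ p.1 * genMat Γ p.2.1) p.2.2.1 p.2.2.2))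

/-- The (possibly non-reduced) ring `A(Γ)` of regular functions on
`R(Γ) = Hom(Γ, SL₂(ℂ))`. It is presented by using all elements of `Γ` as generators and all
products in `Γ` as relations, so that it does not depend on a choice of generators; by
`univRep` and `lift` below it represents `B ↦ Hom(Γ, SL₂(B))` on commutative `ℂ`-algebras, as
does the ring built from any generating family of `Γ` and all the relations in it. -/
abbrev RepRing : Type _ := MvPolynomial (Γ × Fin 2 × Fin 2) ℂ ⧸ repIdeal Γ

/-- The matrix of coordinate functions `ρ ↦ ρ(γ)`. -/
def univMat (γ : Γ) : Matrix (Fin 2) (Fin 2) (RepRing Γ) :=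
  (genMat Γ γ).map (Ideal.Quotient.mk (repIdeal Γ))

lemma univMat_det (γ : Γ) : (univMat Γ γ).det = 1 := by
  have h : (genMat Γ γ).det - 1 ∈ repIdeal Γ :=
    Ideal.subset_span (Or.inl ⟨γ, rfl⟩)
  have h2 := Ideal.Quotient.eq_zero_iff_mem.2 h
  rw [map_sub, map_one, sub_eq_zero, RingHom.map_det] at h2
  exact h2

lemma univMat_mul (γ δ : Γ) : univMat Γ (γ * δ) = univMat Γ γ * univMat Γ δ := by
  have hm : univMat Γ γ * univMat Γ δ
      = (genMat Γ γ * genMat Γ δ).map (Ideal.Quotient.mk (repIdeal Γ)) :=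
    (Matrix.map_mul).symm
  rw [hm]
  ext i j
  have h : (genMat Γ (γ * δ) - genMat Γ γ * genMat Γ δ) i j ∈ repIdeal Γ :=
    Ideal.subset_span (Or.inr ⟨(γ, δ, i, j), rfl⟩)
  exact (Ideal.Quotient.eq.2 h)

/-- The universal representation `Γ → SL₂(A(Γ))`. -/
def univRep : Γ →* SL(2, RepRing Γ) :=
  MonoidHom.mk' (fun γ => ⟨univMat Γ γ, univMat_det Γ γ⟩)
    fun γ δ => Subtype.ext (univMat_mul Γ γ δ)

variable {Γ}

/-- The algebra morphism `A(Γ) → B` given by a representation `Γ → SL₂(B)`. -/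
def lift {B : Type*} [CommRing B] [Algebra ℂ B] (ρ : Γ →* SL(2, B)) : RepRing Γ →ₐ[ℂ] B :=
  Ideal.Quotient.liftₐ (repIdeal Γ)
    (MvPolynomial.aeval fun p : Γ × Fin 2 × Fin 2 => (ρ p.1 : Matrix (Fin 2) (Fin 2) B) p.2.1 p.2.2)
    (by
      set φ : MvPolynomial (Γ × Fin 2 × Fin 2) ℂ →ₐ[ℂ] B := MvPolynomial.aeval
        fun p : Γ × Fin 2 × Fin 2 => (ρ p.1 : Matrix (Fin 2) (Fin 2) B) p.2.1 p.2.2 with hφ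
      have hX : ∀ γ i j, φ (genMat Γ γ i j) = (ρ γ : Matrix (Fin 2) (Fin 2) B) i j := by
        intro γ i j
        simp [hφ, genMat]
      have hle : repIdeal Γ ≤ RingHom.ker φ := by
        refine Ideal.span_le.2 ?_
        rintro _ (⟨γ, rfl⟩ | ⟨⟨γ, δ, i, j⟩, rfl⟩)
        · have h := (ρ γ).2
          rw [Matrix.det_fin_two] at h
          simp [RingHom.mem_ker, Matrix.det_fin_two, hX, h]
        · simp [RingHom.mem_ker, Matrix.mul_apply, hX]
      exact fun a ha => hle ha)

/-- Conjugation by `g ∈ SL₂(ℂ)` on functions: `f ↦ (ρ ↦ f (g ρ g⁻¹))`. -/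
def conjAct (g : SL(2, ℂ)) : RepRing Γ →ₐ[ℂ] RepRing Γ :=
  lift ((MulAut.conj (Matrix.SpecialLinearGroup.map (algebraMap ℂ (RepRing Γ)) g)).toMonoidHom.comp
    (univRep Γ))

lemma lift_univRep {B : Type*} [CommRing B] [Algebra ℂ B] (ρ : Γ →* SL(2, B)) (γ : Γ)
    (i j : Fin 2) :
    lift ρ ((univRep Γ γ : Matrix (Fin 2) (Fin 2) (RepRing Γ)) i j)
      = (ρ γ : Matrix (Fin 2) (Fin 2) B) i j := by
  change lift ρ (Ideal.Quotient.mk (repIdeal Γ) (genMat Γ γ i j)) = _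
  exact (Ideal.Quotient.lift_mk (repIdeal Γ) _ _).trans (MvPolynomial.aeval_X _ (γ, i, j))

lemma lift_trace {B : Type*} [CommRing B] [Algebra ℂ B] (ρ : Γ →* SL(2, B)) (γ : Γ) :
    lift ρ (univRep Γ γ : Matrix (Fin 2) (Fin 2) (RepRing Γ)).trace
      = (ρ γ : Matrix (Fin 2) (Fin 2) B).trace := by
  simp [Matrix.trace_fin_two, lift_univRep]

variable (Γ)

/-- The ring `A(Γ)^{SL₂(ℂ)}` of functions invariant by conjugation, i.e. the ring of regular
functions on the character variety `X(Γ) = R(Γ) // SL₂(ℂ)`. -/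
def charRing : Subalgebra ℂ (RepRing Γ) :=
  ⨅ g : SL(2, ℂ), AlgHom.equalizer (conjAct g) (AlgHom.id ℂ (RepRing Γ))

/-- The trivial character, as a complex point of `X(Γ) = Spec A(Γ)^{SL₂(ℂ)}`: the evaluation
of invariant functions at the trivial representation. -/
def trivialChar : charRing Γ →ₐ[ℂ] ℂ :=
  (lift (1 : Γ →* SL(2, ℂ))).comp (charRing Γ).val

variable {Γ}

/-- The function `t_γ : ρ ↦ Tr ρ(γ)` on the character variety. -/
def traceFn (γ : Γ) : charRing Γ :=
  ⟨(univRep Γ γ : Matrix (Fin 2) (Fin 2) (RepRing Γ)).trace, by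
    rw [charRing, Algebra.mem_iInf]
    intro g
    change conjAct g _ = _
    rw [conjAct, lift_trace]
    set h := Matrix.SpecialLinearGroup.map (algebraMap ℂ (RepRing Γ)) g
    change ((h * univRep Γ γ * h⁻¹ : SL(2, RepRing Γ)) :
      Matrix (Fin 2) (Fin 2) (RepRing Γ)).trace = _
    rw [Matrix.SpecialLinearGroup.coe_mul, Matrix.trace_mul_comm,
      ← Matrix.SpecialLinearGroup.coe_mul, inv_mul_cancel_left]
    rfl⟩

/-- The function `u_γ = t_γ - 2`, which vanishes at the trivial character. -/
def uFn (γ : Γ) : pointIdeal (trivialChar Γ) :=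
  ⟨traceFn γ - 2, by
    have h : trivialChar Γ (traceFn γ) = 2 := by
      have h1 := lift_trace (1 : Γ →* SL(2, ℂ)) γ
      simp only [MonoidHom.one_apply, Matrix.SpecialLinearGroup.coe_one, Matrix.trace_one,
        Fintype.card_fin, Nat.cast_ofNat] at h1
      exact h1
    rw [RingHom.mem_ker, map_sub, h, map_ofNat, sub_self]⟩

end Representations

/-! ### First homology -/

section Homology

variable (Γ : Type) [Group Γ]

/-- The first homology `H₁(Γ, ℂ)` with trivial complex coefficients. -/
abbrev H₁ : Type := groupHomology.H1 (Rep.trivial ℂ Γ ℂ)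

variable {Γ}

/-- The class in `H₁(Γ, ℂ)` of an element of `Γ`. -/
def homologyClass (γ : Γ) : H₁ Γ :=
  groupHomology.mkH1OfIsTrivial (Rep.trivial ℂ Γ ℂ) (Additive.ofMul (Abelianization.of γ)) (1 : ℂ)

end Homology

end CharVar

end

noncomputable section

namespace CharVar

/-! ### Cayley's Ω-process and generation of the invariants by traces -/

section Omega

open MvPolynomial

variable {A : Type*} [CommRing A]

/-! The invariant ring is generated by the traces `t_γ`, even if it is not reduced
(`adjoin_traceFn`, by Cayley's Ω-process), and finitely many of them suffice (`traceAlg_fg`). A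
tangent vector at the trivial character is therefore determined by the function `γ ↦ v(u_γ)`.
Linearizing `t_{xy} + t_{xy⁻¹} = t_x t_y` at `t = 2` shows that this function satisfies the
parallelogram law. Conversely every quadratic form on `H₁` occurs: the arc `diag(exp(ℓ s), exp(-ℓ
s))` has traces `2 + ℓ² s² + ...`, and quadratic forms are combinations of squares `ℓ²`.

For `n < 2`, `parallelogram_eq_zero` bounds the dimension of the tangent space by `n`. If `n = 0`,
then `m = m²` and the point is isolated. If `n = 1`, an integral character `ℓ` gives an arc whose
image is a curve through `χ`; as `m` is locally principal, this curve is all of `X(Γ)` near `χ`.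

For `n > 2`, the Gram determinant of three trace-free parts of matrices against three others factors
(`det_traceForm`): it is `-4` times a product of two alternating functions `D(x) D(y)`. Along a
formal curve with tangent `v` and parameter `z`, the entries of the Gram matrix have order at least
one. Taking `x = y`, `D(x)²` has order at least three, so `D(x)` has order at least two, and every
product `D(x) D(y)` has order at least four. The coefficient of `z³` in the determinant, a `3 × 3`
minor of the Gram matrix of `q` up to a factor, must vanish: `q` has rank at most two
(`det_eq_zero_of_filtration`).

This argument only uses a multiplicative filtration by ideals in which `z` has order exactly one. A
formal deformation yields one by pulling back the powers of `t`. A smooth point yields one for each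
nonzero tangent vector by a dimension count (`exists_curve_of_isSmoothAt`). Hence both obstruction
and non-smoothness. -/

/-- The generic `2 × 2` matrix over `A[g₀₀, g₀₁, g₁₀, g₁₁]`. -/
def genG (A : Type*) [CommRing A] : Matrix (Fin 2) (Fin 2) (MvPolynomial (Fin 2 × Fin 2) A) :=
  Matrix.of fun i j => X (i, j)

/-- Conjugation of a constant matrix by the generic matrix, with denominators cleared. -/
def conjG (a : Matrix (Fin 2) (Fin 2) A) :
    Matrix (Fin 2) (Fin 2) (MvPolynomial (Fin 2 × Fin 2) A) :=
  genG A * a.map C * (genG A).adjugate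

/-- Cayley's operator `∂₀₀∂₁₁ - ∂₀₁∂₁₀`. -/
def omega : MvPolynomial (Fin 2 × Fin 2) A →ₗ[A] MvPolynomial (Fin 2 × Fin 2) A :=
  (pderiv (0, 0)).toLinearMap ∘ₗ (pderiv (1, 1)).toLinearMap -
    (pderiv (0, 1)).toLinearMap ∘ₗ (pderiv (1, 0)).toLinearMap

lemma omega_apply (p : MvPolynomial (Fin 2 × Fin 2) A) :
    omega p = pderiv (0, 0) (pderiv (1, 1) p) - pderiv (0, 1) (pderiv (1, 0) p) := rfl

/-- The symmetric biderivation which is the polarization of Cayley's operator. -/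
def omegaBracket (p q : MvPolynomial (Fin 2 × Fin 2) A) : MvPolynomial (Fin 2 × Fin 2) A :=
  pderiv (0, 0) p * pderiv (1, 1) q + pderiv (1, 1) p * pderiv (0, 0) q -
    pderiv (0, 1) p * pderiv (1, 0) q - pderiv (1, 0) p * pderiv (0, 1) q

lemma omega_mul (p q : MvPolynomial (Fin 2 × Fin 2) A) :
    omega (p * q) = omega p * q + p * omega q + omegaBracket p q := by
  simp only [omega_apply, omegaBracket, Derivation.leibniz, map_add, smul_eq_mul]
  ring

lemma omegaBracket_mul_right (p q r : MvPolynomial (Fin 2 × Fin 2) A) :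
    omegaBracket p (q * r) = omegaBracket p q * r + q * omegaBracket p r := by
  simp only [omegaBracket, Derivation.leibniz, smul_eq_mul]
  ring

lemma omegaBracket_add_right (p q r : MvPolynomial (Fin 2 × Fin 2) A) :
    omegaBracket p (q + r) = omegaBracket p q + omegaBracket p r := by
  simp only [omegaBracket, map_add]
  ring

lemma omegaBracket_add_left (p q r : MvPolynomial (Fin 2 × Fin 2) A) :
    omegaBracket (p + q) r = omegaBracket p r + omegaBracket q r := by
  simp only [omegaBracket, map_add]
  ring

lemma omegaBracket_C_right (p : MvPolynomial (Fin 2 × Fin 2) A) (a : A) :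
    omegaBracket p (C a) = 0 := by
  simp [omegaBracket]

lemma omegaBracket_smul_right (p q : MvPolynomial (Fin 2 × Fin 2) A) (a : A) :
    omegaBracket p (a • q) = a • omegaBracket p q := by
  simp only [omegaBracket, Derivation.map_smul]
  simp only [smul_eq_C_mul]
  ring

lemma omegaBracket_smul_left (p q : MvPolynomial (Fin 2 × Fin 2) A) (a : A) :
    omegaBracket (a • p) q = a • omegaBracket p q := by
  simp only [omegaBracket, Derivation.map_smul]
  simp only [smul_eq_C_mul]
  ring

/-- The determinant of the generic matrix. -/
def detG (A : Type*) [CommRing A] : MvPolynomial (Fin 2 × Fin 2) A := (genG A).det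

lemma detG_eq : detG A = X (0, 0) * X (1, 1) - X (0, 1) * X (1, 0) := by
  simp [detG, Matrix.det_fin_two, genG]

lemma omega_detG : omega (detG A) = 2 := by
  simp [detG_eq, omega_apply, pderiv_X]
  norm_num

lemma omegaBracket_detG : omegaBracket (detG A) (detG A) = 2 * detG A := by
  simp [detG_eq, omegaBracket, pderiv_X]
  ring

lemma omegaBracket_detG_pow (k : ℕ) :
    omegaBracket (detG A) (detG A ^ k) = 2 * (k : MvPolynomial (Fin 2 × Fin 2) A) * detG A ^ k := by
  induction k with
  | zero => simpa using omegaBracket_C_right (detG A) (1 : A)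
  | succ k ih =>
    rw [pow_succ', omegaBracket_mul_right, ih, omegaBracket_detG]
    push_cast
    ring

/-- Cayley's identity for `2 × 2` matrices. -/
lemma omega_detG_pow_succ (k : ℕ) :
    omega (detG A ^ (k + 1)) =
      ((k + 1) * (k + 2) : MvPolynomial (Fin 2 × Fin 2) A) * detG A ^ k := by
  induction k with
  | zero => simp [omega_detG]
  | succ k ih =>
    rw [pow_succ' _ (k + 1), omega_mul, ih, omega_detG, omegaBracket_detG_pow]
    push_cast
    ring

/-- The constant is `k! (k + 1)!`, hence invertible in a complex algebra; this is how `f` is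
recovered from `f • detG ^ k`. -/
lemma iterate_omega_detG_pow (k : ℕ) :
    ∃ c : ℕ, c ≠ 0 ∧ ∀ a : A, omega^[k] (a • detG A ^ k) = C ((c : A) * a) := by
  induction k with
  | zero => exact ⟨1, one_ne_zero, fun a => by simp [smul_eq_C_mul]⟩
  | succ k ih =>
    obtain ⟨c, hc, h⟩ := ih
    refine ⟨c * ((k + 1) * (k + 2)), by positivity, fun a => ?_⟩
    have e : a • (((k + 1) * (k + 2) : MvPolynomial (Fin 2 × Fin 2) A) * detG A ^ k) =
        ((((k + 1) * (k + 2) : ℕ) : A) * a) • detG A ^ k := by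
      simp only [smul_eq_C_mul, map_mul, map_natCast]
      push_cast
      ring
    rw [Function.iterate_succ_apply, map_smul, omega_detG_pow_succ, e, h]
    push_cast
    ring_nf

lemma conjG_apply (a : Matrix (Fin 2) (Fin 2) A) (i j : Fin 2) :
    conjG a i j = ∑ l, (∑ k, X (i, k) * C (a k l)) * (genG A).adjugate l j := by
  simp [conjG, Matrix.mul_apply, genG]

lemma conjG_one : conjG (1 : Matrix (Fin 2) (Fin 2) A) = detG A • 1 := by
  rw [conjG, Matrix.map_one C (map_zero C) (map_one C), mul_one, Matrix.mul_adjugate, detG]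

lemma omega_conjG (a : Matrix (Fin 2) (Fin 2) A) (i j : Fin 2) :
    omega (conjG a i j) = if i = j then C a.trace else 0 := by
  fin_cases i <;> fin_cases j <;>
    simp [conjG_apply, omega_apply, Fin.sum_univ_two, Matrix.adjugate_fin_two, genG, pderiv_X,
      Derivation.leibniz, Matrix.trace_fin_two]
  all_goals ring

/-- The antisymmetric form on `A ^ 2`. -/
def eps (i j : Fin 2) : A := if i = 0 ∧ j = 1 then 1 else if i = 1 ∧ j = 0 then -1 else 0

-- Each conjugate is bilinear in the entries of `g`. The bracket contracts one factor `g` of the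
-- first with one of the second; the four choices give the four terms, each again an entry of a
-- single conjugate.
set_option maxHeartbeats 2000000 in
lemma omegaBracket_conjG (a b : Matrix (Fin 2) (Fin 2) A) (i j k l : Fin 2) :
    omegaBracket (conjG a i j) (conjG b k l) =
      (if j = k then 1 else 0 : A) • conjG (a * b) i l +
      (if i = l then 1 else 0 : A) • conjG (b * a) k j +
      ∑ r, (eps i k * eps j r : A) • conjG (a.adjugate * b) r l +
      ∑ r, (eps j l * eps r k : A) • conjG (a * b.adjugate) i r := by
  fin_cases i <;> fin_cases j <;> fin_cases k <;> fin_cases l <;>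
    simp [conjG_apply, omegaBracket, Fin.sum_univ_two, Matrix.adjugate_fin_two, genG, pderiv_X,
      Derivation.leibniz, eps, Matrix.mul_apply, Matrix.vecMul, dotProduct]
  all_goals ring

end Omega

/-! ### Invariants of a representation are polynomials in its traces. -/

section TraceSpan

open MvPolynomial

variable {Γ : Type*} [Group Γ] {A : Type*} [CommRing A] [Algebra ℂ A] (ρ : Γ →* SL(2, A))

/-- The subalgebra generated by the traces of a representation. -/
def traceAlg : Subalgebra ℂ A :=
  Algebra.adjoin ℂ (Set.range fun γ => (ρ γ : Matrix (Fin 2) (Fin 2) A).trace)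

lemma trace_mem_traceAlg (γ : Γ) : (ρ γ : Matrix (Fin 2) (Fin 2) A).trace ∈ traceAlg ρ :=
  Algebra.subset_adjoin ⟨γ, rfl⟩

/-- The module over the trace algebra spanned by the entries of the conjugates of the `ρ γ` by the
generic matrix. -/
def conjSpan : Submodule (traceAlg ρ) (MvPolynomial (Fin 2 × Fin 2) A) :=
  Submodule.span (traceAlg ρ)
    (Set.range fun p : Γ × Fin 2 × Fin 2 =>
      conjG (ρ p.1 : Matrix (Fin 2) (Fin 2) A) p.2.1 p.2.2)

lemma conjG_mem_conjSpan (γ : Γ) (i j : Fin 2) :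
    conjG (ρ γ : Matrix (Fin 2) (Fin 2) A) i j ∈ conjSpan ρ :=
  Submodule.subset_span ⟨(γ, i, j), rfl⟩

/-- In `SL₂` the adjugate is the inverse, so the matrices produced by `omegaBracket_conjG` are again
values of `ρ`. -/
lemma omegaBracket_mem_conjSpan {p q : MvPolynomial (Fin 2 × Fin 2) A} (hp : p ∈ conjSpan ρ)
    (hq : q ∈ conjSpan ρ) : omegaBracket p q ∈ conjSpan ρ := by
  have hsmul (c : ℂ) (γ : Γ) (i j : Fin 2) :
      (algebraMap ℂ A c) • conjG (ρ γ : Matrix (Fin 2) (Fin 2) A) i j ∈ conjSpan ρ := by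
    have := (conjSpan ρ).smul_mem (algebraMap ℂ (traceAlg ρ) c) (conjG_mem_conjSpan ρ γ i j)
    exact this
  have heps (i j k l : Fin 2) : (eps i j * eps k l : A) = algebraMap ℂ A (eps i j * eps k l) := by
    simp only [eps, map_mul]
    split_ifs <;> simp
  have hite (P : Prop) [Decidable P] :
      (if P then 1 else 0 : A) = algebraMap ℂ A (if P then 1 else 0) := by
    split_ifs <;> simp
  induction hp using Submodule.span_induction with
  | zero => simp [omegaBracket]
  | add x y _ _ hx hy => rw [omegaBracket_add_left]; exact add_mem hx hy
  | smul a x _ hx =>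
    have := (conjSpan ρ).smul_mem a hx
    change omegaBracket ((a : A) • x) q ∈ _
    rw [omegaBracket_smul_left]
    exact this
  | mem x hx =>
    obtain ⟨⟨γ, i, j⟩, rfl⟩ := hx
    induction hq using Submodule.span_induction with
    | zero => simp [omegaBracket]
    | add x y _ _ hx hy => rw [omegaBracket_add_right]; exact add_mem hx hy
    | smul a x _ hx =>
      have := (conjSpan ρ).smul_mem a hx
      change omegaBracket _ ((a : A) • x) ∈ _
      rw [omegaBracket_smul_right]
      exact this
    | mem y hy =>
      obtain ⟨⟨δ, k, l⟩, rfl⟩ := hy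
      simp only [omegaBracket_conjG, ← Matrix.SpecialLinearGroup.coe_mul,
        ← Matrix.SpecialLinearGroup.coe_inv, ← map_mul, ← map_inv, heps, hite]
      refine add_mem (add_mem (add_mem ?_ ?_) (sum_mem fun r _ => ?_)) (sum_mem fun r _ => ?_)
      all_goals exact hsmul _ _ _ _

lemma omegaBracket_mem_conjSpan_pow {p q : MvPolynomial (Fin 2 × Fin 2) A} (hp : p ∈ conjSpan ρ)
    (d : ℕ) (hq : q ∈ conjSpan ρ ^ d) : omegaBracket p q ∈ conjSpan ρ ^ d := by
  induction d generalizing q with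
  | zero =>
    rw [pow_zero, Submodule.mem_one] at hq
    obtain ⟨a, rfl⟩ := hq
    have : omegaBracket p (algebraMap (traceAlg ρ) (MvPolynomial (Fin 2 × Fin 2) A) a) = 0 :=
      omegaBracket_C_right p (a : A)
    rw [this]
    exact zero_mem _
  | succ d ih =>
    rw [pow_succ'] at hq ⊢
    induction hq using Submodule.mul_induction_on' with
    | mem_mul_mem x hx y hy =>
      rw [omegaBracket_mul_right]
      exact add_mem (Submodule.mul_mem_mul (omegaBracket_mem_conjSpan ρ hp hx) hy)
        (Submodule.mul_mem_mul hx (ih hy))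
    | add x _ y _ hx hy => rw [omegaBracket_add_right]; exact add_mem hx hy

lemma omega_mem_one {p : MvPolynomial (Fin 2 × Fin 2) A} (hp : p ∈ conjSpan ρ) :
    omega p ∈ (1 : Submodule (traceAlg ρ) (MvPolynomial (Fin 2 × Fin 2) A)) := by
  induction hp using Submodule.span_induction with
  | zero => simp
  | add x y _ _ hx hy => rw [map_add]; exact add_mem hx hy
  | smul a x _ hx =>
    have := (1 : Submodule (traceAlg ρ) (MvPolynomial (Fin 2 × Fin 2) A)).smul_mem a hx
    change omega ((a : A) • x) ∈ _
    rw [map_smul]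
    exact this
  | mem x hx =>
    obtain ⟨⟨γ, i, j⟩, rfl⟩ := hx
    simp only [omega_conjG]
    split_ifs
    · exact Submodule.mem_one.2 ⟨⟨_, trace_mem_traceAlg ρ γ⟩, rfl⟩
    · exact zero_mem _

/-- Each application of Ω lowers the degree by one: it either turns a factor into a trace or merges
two factors into one. -/
lemma omega_mem_conjSpan_pow (d : ℕ) {p : MvPolynomial (Fin 2 × Fin 2) A}
    (hp : p ∈ conjSpan ρ ^ (d + 1)) : omega p ∈ conjSpan ρ ^ d := by
  induction d generalizing p with
  | zero => simpa using omega_mem_one ρ (by simpa using hp)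
  | succ d ih =>
    rw [pow_succ'] at hp
    induction hp using Submodule.mul_induction_on' with
    | mem_mul_mem x hx y hy =>
      rw [omega_mul]
      refine add_mem (add_mem ?_ ?_) (omegaBracket_mem_conjSpan_pow ρ hx _ hy)
      · have := Submodule.mul_mem_mul (omega_mem_one ρ hx) hy
        rwa [one_mul] at this
      · rw [pow_succ']
        exact Submodule.mul_mem_mul hx (ih hy)
    | add x _ y _ hx hy => rw [map_add]; exact add_mem hx hy

lemma iterate_omega_mem_one (d : ℕ) {p : MvPolynomial (Fin 2 × Fin 2) A}
    (hp : p ∈ conjSpan ρ ^ d) :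
    omega^[d] p ∈ (1 : Submodule (traceAlg ρ) (MvPolynomial (Fin 2 × Fin 2) A)) := by
  induction d generalizing p with
  | zero => simpa using hp
  | succ d ih => exact ih (omega_mem_conjSpan_pow ρ d hp)

lemma mem_traceAlg_of_smul_detG_pow_mem {d : ℕ} {f : A}
    (h : f • detG A ^ d ∈ conjSpan ρ ^ d) : f ∈ traceAlg ρ := by
  obtain ⟨c, hc, hcf⟩ := iterate_omega_detG_pow (A := A) d
  obtain ⟨a, ha⟩ := Submodule.mem_one.1 (iterate_omega_mem_one ρ d h)
  rw [hcf] at ha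
  have ha' : (a : A) = (c : A) * f := C_injective _ _ ha
  have hf : f = (c : ℂ)⁻¹ • (a : A) := by
    have : (c : A) * f = (c : ℂ) • f := by rw [Algebra.smul_def, map_natCast]
    rw [ha', this, smul_smul, inv_mul_cancel₀ (by exact_mod_cast hc), one_smul]
  rw [hf]
  exact (traceAlg ρ).smul_mem a.2 _

/-- Evaluation of the generic matrix at a complex matrix. -/
def evalG (A : Type*) [CommRing A] [Algebra ℂ A] (g : Matrix (Fin 2) (Fin 2) ℂ) :
    MvPolynomial (Fin 2 × Fin 2) A →ₐ[A] A :=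
  aeval fun p => algebraMap ℂ A (g p.1 p.2)

lemma map_evalG_genG (g : Matrix (Fin 2) (Fin 2) ℂ) :
    (genG A).map (evalG A g) = g.map (algebraMap ℂ A) := by
  ext i j
  simp [genG, evalG]

lemma evalG_conjG (g : Matrix (Fin 2) (Fin 2) ℂ) (a : Matrix (Fin 2) (Fin 2) A) (i j : Fin 2) :
    evalG A g (conjG a i j) =
      (g.map (algebraMap ℂ A) * a * (g.map (algebraMap ℂ A)).adjugate) i j := by
  rw [← map_evalG_genG]
  fin_cases j <;>
    simp [conjG_apply, Matrix.mul_apply, Fin.sum_univ_two, Matrix.adjugate_fin_two, genG, evalG]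

lemma evalG_detG (g : Matrix (Fin 2) (Fin 2) ℂ) : evalG A g (detG A) = algebraMap ℂ A g.det := by
  simp [detG_eq, evalG, Matrix.det_fin_two]

lemma evalG_smul_of_mem_conjSpan_pow (d : ℕ) {p : MvPolynomial (Fin 2 × Fin 2) A}
    (hp : p ∈ conjSpan ρ ^ d) (c : ℂ) (g : Matrix (Fin 2) (Fin 2) ℂ) :
    evalG A (c • g) p = algebraMap ℂ A (c ^ 2) ^ d * evalG A g p := by
  induction d generalizing p with
  | zero =>
    rw [pow_zero, Submodule.mem_one] at hp
    obtain ⟨a, rfl⟩ := hp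
    have (g : Matrix (Fin 2) (Fin 2) ℂ) :
        evalG A g (algebraMap (traceAlg ρ) (MvPolynomial (Fin 2 × Fin 2) A) a) = a :=
      (evalG A g).commutes (a : A)
    rw [this, this, pow_zero, one_mul]
  | succ d ih =>
    rw [pow_succ'] at hp
    induction hp using Submodule.mul_induction_on' with
    | mem_mul_mem x hx y hy =>
      rw [map_mul, map_mul, ih hy]
      have : evalG A (c • g) x = algebraMap ℂ A (c ^ 2) * evalG A g x := by
        clear hy
        induction hx using Submodule.span_induction with
        | zero => simp
        | add x y _ _ hx hy => rw [map_add, map_add, hx, hy, mul_add]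
        | smul a x _ hx =>
          change evalG A (c • g) ((a : A) • x) = _ * evalG A g ((a : A) • x)
          rw [map_smul, map_smul, hx, smul_eq_mul, smul_eq_mul, mul_left_comm]
        | mem x hx =>
          obtain ⟨⟨γ, i, j⟩, rfl⟩ := hx
          simp only [evalG_conjG]
          have : (c • g).map (algebraMap ℂ A) = algebraMap ℂ A c • g.map (algebraMap ℂ A) := by
            ext; simp
          rw [this, Matrix.adjugate_smul]
          simp only [Fintype.card_fin, Nat.add_one_sub_one, pow_one, Matrix.smul_mul,
            Matrix.mul_smul, Matrix.smul_apply, smul_eq_mul, map_pow]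
          ring
      rw [this]
      ring
    | add x _ y _ hx hy => rw [map_add, map_add, hx, hy, mul_add]

/-- A polynomial with coefficients in a complex algebra is determined by its values at the
invertible complex matrices. -/
lemma eq_zero_of_evalG_eq_zero {p : MvPolynomial (Fin 2 × Fin 2) A}
    (h : ∀ g : Matrix (Fin 2) (Fin 2) ℂ, g.det ≠ 0 → evalG A g p = 0) : p = 0 := by
  ext m
  rw [coeff_zero]
  -- `A` may have zero divisors and nilpotents; applying linear forms to the coefficients reduces to
  -- polynomials over `ℂ`.
  refine (Module.forall_dual_apply_eq_zero_iff ℂ _).1 fun φ => ?_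
  set p' : MvPolynomial (Fin 2 × Fin 2) ℂ := ∑ m ∈ p.support, monomial m (φ (p.coeff m)) with hp'
  have hcoeff (m) : p'.coeff m = φ (p.coeff m) := by
    simp only [hp', coeff_sum, coeff_monomial, Finset.sum_ite_eq', mem_support_iff]
    split_ifs with hm
    · rfl
    · rw [notMem_support_iff.1 hm, map_zero]
  have heval (g : Matrix (Fin 2) (Fin 2) ℂ) :
      eval (fun x => g x.1 x.2) p' = φ (evalG A g p) := by
    simp only [hp', map_sum, eval_monomial, evalG, aeval_def, eval₂_eq', Algebra.algebraMap_self,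
      RingHom.id_apply, ← map_pow, ← map_prod]
    refine Finset.sum_congr rfl fun m _ => ?_
    rw [mul_comm (p.coeff m), ← Algebra.smul_def, map_smul, smul_eq_mul, mul_comm,
      Finsupp.prod_fintype _ _ fun _ => pow_zero _]
  -- The factor `detG` takes care of the singular matrices, where nothing is assumed.
  have hz : p' * detG ℂ = 0 := by
    refine funext fun x => ?_
    have hx := heval (Matrix.of fun i j => x (i, j))
    simp only [Matrix.of_apply, Prod.mk.eta] at hx
    by_cases hd : (Matrix.of fun i j => x (i, j)).det = 0
    · have : eval x (detG ℂ) = 0 := by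
        rw [← hd]
        simp [detG_eq, Matrix.det_fin_two]
      rw [map_mul, this, mul_zero, map_zero]
    · rw [map_mul, hx, h _ hd, map_zero, zero_mul, map_zero]
  have hd : detG ℂ ≠ 0 := fun h0 => by
    have := omega_detG (A := ℂ)
    rw [h0, map_zero] at this
    exact two_ne_zero this.symm
  rw [← hcoeff, (mul_eq_zero.1 hz).resolve_right hd, coeff_zero]

/-- On `SL₂(ℂ)`, `p` equals `f • detG ^ d`. Both are homogeneous of degree `2 d` in `g`, and every
invertible complex matrix is a scalar times one of determinant one, so they coincide; Ω then
applies. -/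
lemma mem_traceAlg_of_evalG_eq {d : ℕ} {p : MvPolynomial (Fin 2 × Fin 2) A} {f : A}
    (hp : p ∈ conjSpan ρ ^ d) (hf : ∀ g : SL(2, ℂ), evalG A g p = f) : f ∈ traceAlg ρ := by
  suffices h : p - f • detG A ^ d = 0 by
    refine mem_traceAlg_of_smul_detG_pow_mem ρ (d := d) ?_
    rwa [← sub_eq_zero.1 h]
  refine eq_zero_of_evalG_eq_zero fun g hg => ?_
  obtain ⟨c, hc⟩ := IsAlgClosed.exists_pow_nat_eq g.det two_pos
  have hc0 : c ≠ 0 := by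
    rintro rfl
    exact hg (by simpa using hc.symm)
  have hdet : (c⁻¹ • g).det = 1 := by
    rw [Matrix.det_smul, Fintype.card_fin, ← hc, ← mul_pow, inv_mul_cancel₀ hc0, one_pow]
  have h1 := hf ⟨c⁻¹ • g, hdet⟩
  have h2 := evalG_smul_of_mem_conjSpan_pow ρ d hp c (c⁻¹ • g)
  rw [smul_smul, mul_inv_cancel₀ hc0, one_smul] at h2
  change evalG A (c⁻¹ • g) p = f at h1
  rw [map_sub, h2, h1, map_smul, map_pow (evalG A g), evalG_detG, hc, smul_eq_mul, mul_comm,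
    sub_self]

/-- The determinant is the `(0, 0)` entry of the conjugate of `ρ 1`, so multiplying by it raises the
degree without changing the values on `SL₂(ℂ)`. -/
lemma detG_pow_mul_mem {d : ℕ} {p : MvPolynomial (Fin 2 × Fin 2) A}
    (hp : p ∈ conjSpan ρ ^ d) (e : ℕ) : detG A ^ e * p ∈ conjSpan ρ ^ (e + d) := by
  rw [pow_add]
  refine Submodule.mul_mem_mul (Submodule.pow_mem_pow _ ?_ _) hp
  have := conjG_mem_conjSpan ρ 1 0 0
  rwa [map_one, Matrix.SpecialLinearGroup.coe_one, conjG_one, Matrix.smul_apply,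
    Matrix.one_apply_eq, smul_eq_mul, mul_one] at this

/-- The orbit map of a function is polynomial in `g`. For sums, powers of `detG` bring both terms to
the same degree. -/
lemma exists_evalG_eq {κ : SL(2, ℂ) → A →ₐ[ℂ] A}
    (hκ : ∀ g γ i j, κ g ((ρ γ : Matrix (Fin 2) (Fin 2) A) i j) =
      evalG A g (conjG (ρ γ : Matrix (Fin 2) (Fin 2) A) i j)) {a : A}
    (ha : a ∈ Algebra.adjoin ℂ (Set.range fun p : Γ × Fin 2 × Fin 2 =>
      (ρ p.1 : Matrix (Fin 2) (Fin 2) A) p.2.1 p.2.2)) :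
    ∃ d, ∃ p ∈ conjSpan ρ ^ d, ∀ g : SL(2, ℂ), evalG A g p = κ g a := by
  have hdet (g : SL(2, ℂ)) : evalG A g (detG A) = 1 := by
    rw [evalG_detG, g.2, map_one]
  induction ha using Algebra.adjoin_induction with
  | mem x hx =>
    obtain ⟨⟨γ, i, j⟩, rfl⟩ := hx
    refine ⟨1, _, ?_, fun g => (hκ g γ i j).symm⟩
    rw [pow_one]
    exact conjG_mem_conjSpan _ _ _ _
  | algebraMap r =>
    refine ⟨0, algebraMap (traceAlg ρ) _ (algebraMap ℂ _ r), ?_, fun g => ?_⟩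
    · rw [pow_zero]
      exact Submodule.mem_one.2 ⟨_, rfl⟩
    · rw [AlgHom.commutes]
      exact (evalG A g).commutes (algebraMap ℂ _ r)
  | add x y _ _ hx hy =>
    obtain ⟨d, p, hp, hpe⟩ := hx
    obtain ⟨e, q, hq, hqe⟩ := hy
    refine ⟨e + d, detG _ ^ e * p + detG _ ^ d * q, add_mem (detG_pow_mul_mem ρ hp e) ?_,
      fun g => ?_⟩
    · rw [add_comm e d]
      exact detG_pow_mul_mem ρ hq d
    · simp only [map_add, map_mul, map_pow, hdet, hpe, hqe, one_pow, one_mul]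
  | mul x y _ _ hx hy =>
    obtain ⟨d, p, hp, hpe⟩ := hx
    obtain ⟨e, q, hq, hqe⟩ := hy
    refine ⟨d + e, p * q, ?_, fun g => ?_⟩
    · rw [pow_add]
      exact Submodule.mul_mem_mul hp hq
    · rw [map_mul, map_mul, hpe, hqe]

/-- An element fixed by all conjugations is a polynomial in the traces. -/
lemma mem_traceAlg_of_invariant {κ : SL(2, ℂ) → A →ₐ[ℂ] A}
    (hκ : ∀ g γ i j, κ g ((ρ γ : Matrix (Fin 2) (Fin 2) A) i j) =
      evalG A g (conjG (ρ γ : Matrix (Fin 2) (Fin 2) A) i j)) {a : A}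
    (ha : a ∈ Algebra.adjoin ℂ (Set.range fun p : Γ × Fin 2 × Fin 2 =>
      (ρ p.1 : Matrix (Fin 2) (Fin 2) A) p.2.1 p.2.2))
    (hinv : ∀ g, κ g a = a) : a ∈ traceAlg ρ := by
  obtain ⟨d, p, hp, h⟩ := exists_evalG_eq ρ hκ ha
  exact mem_traceAlg_of_evalG_eq ρ hp fun g => (h g).trans (hinv g)

end TraceSpan

/-! ### The coordinate ring of the character variety. -/

section Invariants

variable {Γ : Type*} [Group Γ]

lemma conjAct_univMat (g : SL(2, ℂ)) (γ : Γ) (i j : Fin 2) :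
    conjAct g (univMat Γ γ i j) =
      evalG (RepRing Γ) g (conjG (univRep Γ γ : Matrix (Fin 2) (Fin 2) (RepRing Γ)) i j) := by
  rw [evalG_conjG]
  have := lift_univRep ((MulAut.conj
    (Matrix.SpecialLinearGroup.map (algebraMap ℂ (RepRing Γ)) g)).toMonoidHom.comp
      (univRep Γ)) γ i j
  refine this.trans ?_
  simp only [MonoidHom.comp_apply, MulEquiv.coe_toMonoidHom, MulAut.conj_apply,
    Matrix.SpecialLinearGroup.coe_mul, Matrix.SpecialLinearGroup.coe_inv]
  rfl

lemma adjoin_univMat :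
    Algebra.adjoin ℂ (Set.range fun p : Γ × Fin 2 × Fin 2 => univMat Γ p.1 p.2.1 p.2.2) = ⊤ := by
  have h := MvPolynomial.adjoin_range_X (R := ℂ) (σ := Γ × Fin 2 × Fin 2)
  have h2 := congrArg (Subalgebra.map (Ideal.Quotient.mkₐ ℂ (repIdeal Γ))) h
  rw [AlgHom.map_adjoin, ← Set.range_comp, Algebra.map_top,
    (AlgHom.range_eq_top _).2 (Ideal.Quotient.mkₐ_surjective ℂ _)] at h2
  exact h2

lemma charRing_le_traceAlg : charRing Γ ≤ traceAlg (univRep Γ) := fun f hf => by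
  refine mem_traceAlg_of_invariant (univRep Γ) (κ := conjAct) conjAct_univMat ?_ ?_
  · exact adjoin_univMat (Γ := Γ) ▸ Algebra.mem_top
  · rw [charRing, Algebra.mem_iInf] at hf
    exact hf

/-- The ring of regular functions on the character variety is generated by the traces. -/
lemma adjoin_traceFn : Algebra.adjoin ℂ (Set.range (traceFn (Γ := Γ))) = ⊤ := by
  refine Subalgebra.map_injective (f := (charRing Γ).val) Subtype.val_injective ?_
  rw [AlgHom.map_adjoin, ← Set.range_comp, Algebra.map_top, Subalgebra.range_val]
  refine le_antisymm (Algebra.adjoin_le ?_) charRing_le_traceAlg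
  rintro _ ⟨γ, rfl⟩
  exact (traceFn γ).2

end Invariants

/-! ### Finite generation -/

section FiniteGeneration

variable {A : Type*} [CommRing A]

lemma mul_self_of_det_eq_one {X : Matrix (Fin 2) (Fin 2) A} (hX : X.det = 1) :
    X * X = X.trace • X - 1 := by
  rw [Matrix.det_fin_two] at hX
  ext i j
  fin_cases i <;> fin_cases j <;> simp [Matrix.mul_apply, Matrix.trace_fin_two, ← hX] <;> ring

/-- Polarized Cayley–Hamilton: modulo terms of lower degree with coefficients in the traces, two
matrices anticommute. -/
lemma mul_comm_eq (X Y : Matrix (Fin 2) (Fin 2) A) :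
    X * Y = X.trace • Y + Y.trace • X + ((X * Y).trace - X.trace * Y.trace) • 1 - Y * X := by
  ext i j
  fin_cases i <;> fin_cases j <;> simp [Matrix.mul_apply, Matrix.trace_fin_two, Fin.sum_univ_two] <;> ring

variable [Algebra ℂ A]

/-- The span over a subalgebra of the products of the increasing subfamilies of a list. -/
def orderedSpan (B : Subalgebra ℂ A) :
    List (Matrix (Fin 2) (Fin 2) A) → Submodule B (Matrix (Fin 2) (Fin 2) A)
  | [] => Submodule.span B {1}
  | X :: l => orderedSpan B l ⊔ (orderedSpan B l).map (LinearMap.mulLeft B X)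

lemma orderedSpan_eq_span (B : Subalgebra ℂ A) (l : List (Matrix (Fin 2) (Fin 2) A)) :
    orderedSpan B l = Submodule.span B {Y | ∃ l' ∈ l.sublists, Y = l'.prod} := by
  induction l with
  | nil => simp [orderedSpan]
  | cons X l ih =>
    rw [orderedSpan, ih, Submodule.map_span, ← Submodule.span_union]
    congr 1
    ext Y
    simp only [List.mem_sublists, Set.mem_union, Set.mem_ofPred_eq, Set.mem_image,
      LinearMap.mulLeft_apply, List.sublist_cons_iff]
    constructor
    · rintro (⟨l', hl', rfl⟩ | ⟨_, ⟨l', hl', rfl⟩, rfl⟩)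
      · exact ⟨l', Or.inl hl', rfl⟩
      · exact ⟨X :: l', Or.inr ⟨l', rfl, hl'⟩, by simp⟩
    · rintro ⟨l', (hl' | ⟨r, rfl, hr⟩), rfl⟩
      · exact Or.inl ⟨l', hl', rfl⟩
      · exact Or.inr ⟨_, ⟨r, hr, rfl⟩, by simp⟩

/-- Words are sorted by `mul_comm_eq`, and repeated letters are removed by Cayley–Hamilton; only
traces of one or two letters are needed as scalars. -/
lemma mul_mem_orderedSpan (B : Subalgebra ℂ A) (l : List (Matrix (Fin 2) (Fin 2) A))
    (hdet : ∀ X ∈ l, X.det = 1) (h1 : ∀ X ∈ l, X.trace ∈ B)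
    (h2 : ∀ X ∈ l, ∀ Y ∈ l, (X * Y).trace ∈ B) (X : Matrix (Fin 2) (Fin 2) A) (hX : X ∈ l)
    {Z : Matrix (Fin 2) (Fin 2) A} (hZ : Z ∈ orderedSpan B l) : X * Z ∈ orderedSpan B l := by
  induction l generalizing X Z with
  | nil => simp at hX
  | cons Y l ih =>
    replace ih := ih (fun X hX => hdet X (List.mem_cons_of_mem _ hX))
      (fun X hX => h1 X (List.mem_cons_of_mem _ hX))
      (fun X hX Y hY => h2 X (List.mem_cons_of_mem _ hX) Y (List.mem_cons_of_mem _ hY))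
    have hl {Z} (h : Z ∈ orderedSpan B l) : Z ∈ orderedSpan B (Y :: l) :=
      Submodule.mem_sup_left h
    have hY {Z} (h : Z ∈ orderedSpan B l) : Y * Z ∈ orderedSpan B (Y :: l) :=
      Submodule.mem_sup_right ⟨Z, h, rfl⟩
    have hs {Z} {b : A} (hb : b ∈ B) (h : Z ∈ orderedSpan B (Y :: l)) :
        b • Z ∈ orderedSpan B (Y :: l) :=
      (orderedSpan B (Y :: l)).smul_mem ⟨b, hb⟩ h
    obtain ⟨Z₁, hZ₁, _, ⟨Z₂, hZ₂, rfl⟩, rfl⟩ := Submodule.mem_sup.1 hZ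
    rw [mul_add, LinearMap.mulLeft_apply, ← mul_assoc]
    have hYm : Y ∈ Y :: l := List.mem_cons_self
    rcases List.mem_cons.1 hX with rfl | hXl
    · refine add_mem (hY hZ₁) ?_
      rw [mul_self_of_det_eq_one (hdet _ hX), sub_mul, smul_mul_assoc, one_mul]
      exact sub_mem (hs (h1 _ hX) (hY hZ₂)) (hl hZ₂)
    · refine add_mem (hl (ih X hXl hZ₁)) ?_
      rw [mul_comm_eq X Y, sub_mul, add_mul, add_mul, smul_mul_assoc, smul_mul_assoc,
        smul_mul_assoc, one_mul, mul_assoc]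
      exact sub_mem (add_mem (add_mem (hs (h1 _ hX) (hY hZ₂)) (hs (h1 _ hYm) (hl (ih X hXl hZ₂))))
        (hs (sub_mem (h2 _ hX _ hYm) (mul_mem (h1 _ hX) (h1 _ hYm))) (hl hZ₂))) (hY (ih X hXl hZ₂))

lemma one_mem_orderedSpan (B : Subalgebra ℂ A) (l : List (Matrix (Fin 2) (Fin 2) A)) :
    1 ∈ orderedSpan B l := by
  rw [orderedSpan_eq_span]
  exact Submodule.subset_span ⟨[], by simp, by simp⟩

variable {Γ : Type*} [Group Γ]

/-- The trace algebra of a representation of a finitely generated group is finitely generated. -/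
lemma traceAlg_fg [Group.FG Γ] (ρ : Γ →* SL(2, A)) : (traceAlg ρ).FG := by
  classical
  obtain ⟨S, hS⟩ := Group.fg_def.1 ‹Group.FG Γ›
  set l : List Γ := S.toList with hl
  -- The traces of increasing products are the traces of the spanning matrices; those of pairs `s *
  -- t` are the scalars needed for sorting.
  set W : Set Γ := {γ | ∃ l' ∈ l.sublists, γ = l'.prod} ∪ {γ | ∃ s ∈ S, ∃ t ∈ S, γ = s * t} with hW
  have hWfin : W.Finite := by
    refine Set.Finite.union ?_ ?_
    · refine ((l.sublists.toFinset.finite_toSet).image List.prod).subset ?_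
      rintro _ ⟨l', hl', rfl⟩
      exact ⟨l', by simpa using hl', rfl⟩
    · refine ((S ×ˢ S).finite_toSet.image fun p => p.1 * p.2).subset ?_
      rintro _ ⟨s, hs, t, ht, rfl⟩
      exact ⟨(s, t), by simp [hs, ht], rfl⟩
  set τ : Γ → A := fun γ => (ρ γ : Matrix (Fin 2) (Fin 2) A).trace with hτ
  set B : Subalgebra ℂ A := Algebra.adjoin ℂ (τ '' W) with hB
  have hBW {γ} (h : γ ∈ W) : τ γ ∈ B := Algebra.subset_adjoin ⟨γ, h, rfl⟩
  set L := l.map fun γ => (ρ γ : Matrix (Fin 2) (Fin 2) A) with hL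
  have hLmem {X} (hX : X ∈ L) : ∃ s ∈ S, X = ρ s := by
    obtain ⟨s, hs, rfl⟩ := List.mem_map.1 hX
    exact ⟨s, by simpa [hl] using hs, rfl⟩
  have hS1 {s} (hs : s ∈ S) : τ s ∈ B :=
    hBW (Or.inl ⟨[s], by simpa [hl] using hs, by simp⟩)
  have hmul : ∀ X ∈ L, ∀ Z ∈ orderedSpan B L, X * Z ∈ orderedSpan B L := by
    intro X hX Z hZ
    refine mul_mem_orderedSpan B L ?_ ?_ ?_ X hX hZ
    · intro X hX
      obtain ⟨s, hs, rfl⟩ := hLmem hX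
      exact (ρ s).2
    · intro X hX
      obtain ⟨s, hs, rfl⟩ := hLmem hX
      exact hS1 hs
    · intro X hX Y hY
      obtain ⟨s, hs, rfl⟩ := hLmem hX
      obtain ⟨t, ht, rfl⟩ := hLmem hY
      have := hBW (γ := s * t) (Or.inr ⟨s, hs, t, ht, rfl⟩)
      simpa only [hτ, map_mul, Matrix.SpecialLinearGroup.coe_mul] using this
  have hmem (γ : Γ) : ∀ Z ∈ orderedSpan B L,
      (ρ γ : Matrix (Fin 2) (Fin 2) A) * Z ∈ orderedSpan B L := by
    have hγ : γ ∈ Subgroup.closure (S : Set Γ) := hS ▸ Subgroup.mem_top γ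
    have hgen {s} (hs : s ∈ (S : Set Γ)) : (ρ s : Matrix (Fin 2) (Fin 2) A) ∈ L :=
      List.mem_map.2 ⟨s, by simpa [hl] using hs, rfl⟩
    induction hγ using Subgroup.closure_induction'' with
    | one => simp
    | mem s hs => exact hmul _ (hgen hs)
    | inv_mem s hs =>
      intro Z hZ
      have hinv : ((ρ s⁻¹ : SL(2, A)) : Matrix (Fin 2) (Fin 2) A) = τ s • 1 - ρ s := by
        rw [map_inv, Matrix.SpecialLinearGroup.coe_inv, Matrix.adjugate_fin_two]
        ext i j
        fin_cases i <;> fin_cases j <;> simp [hτ, Matrix.trace_fin_two]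
      rw [hinv, sub_mul, smul_mul_assoc, one_mul]
      exact sub_mem ((orderedSpan B L).smul_mem ⟨_, hS1 hs⟩ hZ) (hmul _ (hgen hs) _ hZ)
    | mul x y _ _ hx hy =>
      intro Z hZ
      rw [map_mul, Matrix.SpecialLinearGroup.coe_mul, mul_assoc]
      exact hx _ (hy _ hZ)
  refine (Subalgebra.fg_def).2 ⟨τ '' W, hWfin.image _, le_antisymm ?_ (Algebra.adjoin_le ?_)⟩
  · refine Algebra.adjoin_mono ?_
    rintro _ ⟨γ, -, rfl⟩
    exact ⟨γ, rfl⟩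
  · rintro _ ⟨γ, rfl⟩
    have h := hmem γ 1 (one_mem_orderedSpan B L)
    rw [mul_one, orderedSpan_eq_span] at h
    change (ρ γ : Matrix (Fin 2) (Fin 2) A).trace ∈ B
    generalize (ρ γ : Matrix (Fin 2) (Fin 2) A) = X at h ⊢
    induction h using Submodule.span_induction with
    | zero => simp
    | add x y _ _ hx hy => rw [Matrix.trace_add]; exact add_mem hx hy
    | smul b x _ hx =>
      change ((b : A) • x).trace ∈ B
      rw [Matrix.trace_smul]
      exact mul_mem b.2 hx
    | mem Y hY =>
      obtain ⟨l', hl', rfl⟩ := hY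
      rw [List.mem_sublists, hL, List.sublist_map_iff] at hl'
      obtain ⟨l'', hl'', rfl⟩ := hl'
      have := hBW (γ := l''.prod) (Or.inl ⟨l'', List.mem_sublists.2 hl'', rfl⟩)
      have e (l : List Γ) : ((ρ l.prod : SL(2, A)) : Matrix (Fin 2) (Fin 2) A) =
          (l.map fun γ => (ρ γ : Matrix (Fin 2) (Fin 2) A)).prod := by
        induction l with
        | nil => simp
        | cons a t ih =>
          rw [List.prod_cons, map_mul, Matrix.SpecialLinearGroup.coe_mul, List.map_cons,
            List.prod_cons, ih]
      simpa only [hτ, e] using this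

instance charRing_finiteType [Group.FG Γ] : Algebra.FiniteType ℂ (charRing Γ) := by
  have h : charRing Γ = traceAlg (univRep Γ) := by
    refine le_antisymm charRing_le_traceAlg (Algebra.adjoin_le ?_)
    rintro _ ⟨γ, rfl⟩
    exact (traceFn γ).2
  rw [← Subalgebra.fg_iff_finiteType, h]
  exact traceAlg_fg _

end FiniteGeneration

/-! ### The parallelogram law on groups -/

section Parallelogram

variable {Γ : Type*} [Group Γ] {φ : Γ → ℂ}

/-- The polarization of a function on a group. -/
def polarG (φ : Γ → ℂ) (x y : Γ) : ℂ := φ (x * y) - φ x - φ y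

/-- The defect of additivity of the polarization. -/
def triG (φ : Γ → ℂ) (x y z : Γ) : ℂ := polarG φ x (y * z) - polarG φ x y - polarG φ x z

lemma parallelogram_one (hp : ∀ x y, φ (x * y) + φ (x * y⁻¹) = 2 * φ x + 2 * φ y) :
    φ 1 = 0 := by
  have := hp 1 1
  simp only [inv_one, mul_one] at this
  linear_combination (-1 / 2) * this

lemma parallelogram_inv (hp : ∀ x y, φ (x * y) + φ (x * y⁻¹) = 2 * φ x + 2 * φ y)
    (x : Γ) : φ x⁻¹ = φ x := by
  have := hp 1 x
  simp only [one_mul, parallelogram_one hp] at this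
  linear_combination this

lemma triG_cycle (hc : ∀ x y, φ (x * y) = φ (y * x)) (x y z : Γ) :
    triG φ x y z = triG φ y z x := by
  have h1 : φ (x * (y * z)) = φ (y * (z * x)) := by rw [hc, mul_assoc]
  simp only [triG, polarG, h1, hc x z, hc x y]
  ring

lemma polarG_inv_left (hc : ∀ x y, φ (x * y) = φ (y * x))
    (hp : ∀ x y, φ (x * y) + φ (x * y⁻¹) = 2 * φ x + 2 * φ y) (x y : Γ) :
    polarG φ x⁻¹ y = -polarG φ x y := by
  have := hp y x
  simp only [polarG, parallelogram_inv hp, hc x y, hc x⁻¹ y]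
  linear_combination this

lemma triG_inv_left (hc : ∀ x y, φ (x * y) = φ (y * x))
    (hp : ∀ x y, φ (x * y) + φ (x * y⁻¹) = 2 * φ x + 2 * φ y) (x y z : Γ) :
    triG φ x⁻¹ y z = -triG φ x y z := by
  simp only [triG, polarG_inv_left hc hp]
  ring

/-- Inverting all three arguments gives three signs; on the other hand `φ x⁻¹ = φ x` makes it
reverse the order of the products. -/
lemma triG_antisymm (hc : ∀ x y, φ (x * y) = φ (y * x))
    (hp : ∀ x y, φ (x * y) + φ (x * y⁻¹) = 2 * φ x + 2 * φ y) (x y z : Γ) :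
    triG φ x y z = -triG φ z y x := by
  have h1 : triG φ z⁻¹ y⁻¹ x⁻¹ = triG φ x y z := by
    have e (a b : Γ) : φ (a⁻¹ * b⁻¹) = φ (b * a) := by
      rw [← mul_inv_rev, parallelogram_inv hp]
    have e3 : φ (z⁻¹ * (y⁻¹ * x⁻¹)) = φ (x * (y * z)) := by
      rw [← mul_inv_rev, ← mul_inv_rev, parallelogram_inv hp, mul_assoc]
    simp only [triG, polarG, e, e3, parallelogram_inv hp]
    ring
  rw [← h1, triG_inv_left hc hp, triG_cycle hc, triG_inv_left hc hp, triG_cycle hc,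
    triG_inv_left hc hp, triG_cycle hc]
  ring

/-- The defect `L` of additivity is invariant under cyclic permutation of its four arguments, by the
cocycle identity, and changes sign under a transposition. A 4-cycle is an odd permutation, so `L =
-L`. -/
lemma triG_mul_right (hc : ∀ x y, φ (x * y) = φ (y * x))
    (hp : ∀ x y, φ (x * y) + φ (x * y⁻¹) = 2 * φ x + 2 * φ y) (x y z w : Γ) :
    triG φ x y (z * w) = triG φ x y z + triG φ x y w := by
  set L : Γ → Γ → Γ → Γ → ℂ := fun x y z w => triG φ x y (z * w) - triG φ x y z - triG φ x y w
    with hL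
  have hcyc (x y z w : Γ) : L x y z w = L w x y z := by
    have h : triG φ x y z + triG φ x (y * z) w = triG φ x y (z * w) + triG φ x z w := by
      simp only [triG, mul_assoc]
      ring
    simp only [hL]
    rw [triG_cycle hc w x (y * z), triG_cycle hc w x y, triG_cycle hc w x z]
    linear_combination -h
  have hswap (x y z w : Γ) : L x y z w = -L y x z w := by
    have h (u : Γ) : triG φ x y u = -triG φ y x u := by
      rw [triG_antisymm hc hp, triG_cycle hc u y x]
    simp only [hL, h]
    ring
  have h0 : L x y z w = 0 := by
    have h : L x y z w = -L x y z w := by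
      calc L x y z w = L z y w x := by
            rw [hswap, hcyc y x z w, hswap, hcyc y w x z, neg_neg]
        _ = -L x y z w := by rw [hswap, hcyc y z w x]
    linear_combination h / 2
  simp only [hL] at h0
  linear_combination h0

/-- If all homomorphisms `Γ → ℂ` vanish as soon as they vanish at `γ₀`, the same holds for the
central solutions of the parallelogram law. -/
lemma parallelogram_eq_zero (hc : ∀ x y, φ (x * y) = φ (y * x))
    (hp : ∀ x y, φ (x * y) + φ (x * y⁻¹) = 2 * φ x + 2 * φ y) {γ₀ : Γ}
    (h₀ : ∀ f : Γ →* Multiplicative ℂ, f γ₀ = 1 → f = 1) (hφ : φ γ₀ = 0) : φ = 0 := by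
  have key {f : Γ → ℂ} (hf : ∀ x y, f (x * y) = f x + f y) (hf0 : f γ₀ = 0) (x : Γ) : f x = 0 := by
    have := h₀ (MonoidHom.mk' (fun x => Multiplicative.ofAdd (f x)) fun x y => by
      rw [hf, ofAdd_add]) (by simp [hf0])
    simpa using DFunLike.congr_fun this x
  -- Being additive and cyclic, `triG` is determined by its value at `(γ₀, γ₀, γ₀)`, which vanishes
  -- by antisymmetry. The same reduction then applies to the biadditive `polarG`.
  have htri (x y z : Γ) : triG φ x y z = 0 := by
    have h3 (x y : Γ) (h : triG φ x y γ₀ = 0) (z : Γ) : triG φ x y z = 0 :=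
      key (triG_mul_right hc hp x y) h z
    refine h3 x y ?_ z
    rw [triG_cycle hc, triG_cycle hc]
    refine h3 γ₀ x ?_ y
    rw [triG_cycle hc]
    have h0 : triG φ γ₀ γ₀ γ₀ = 0 := by
      linear_combination (1 / 2) * triG_antisymm hc hp γ₀ γ₀ γ₀
    rw [triG_cycle hc]
    exact h3 γ₀ γ₀ h0 x
  have hadd (x y z : Γ) : polarG φ x (y * z) = polarG φ x y + polarG φ x z := by
    have := htri x y z
    rw [triG] at this
    linear_combination this
  have hsymm (x y : Γ) : polarG φ x y = polarG φ y x := by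
    simp only [polarG, hc x y]
    ring
  have hdiag (x : Γ) : polarG φ x x = 2 * φ x := by
    have := hp x x
    rw [mul_inv_cancel, parallelogram_one hp] at this
    simp only [polarG]
    linear_combination this
  have hB (x y : Γ) : polarG φ x y = 0 := by
    refine key (hadd x) ?_ y
    rw [hsymm]
    exact key (hadd γ₀) (by rw [hdiag, hφ, mul_zero]) x
  funext x
  have := hdiag x
  rw [hB] at this
  simpa using this.symm

end Parallelogram

/-! ### Tangent vectors and local dimension of affine schemes -/

section LocalGeometry

open PrimeSpectrum TopologicalSpace

variable {R : Type*} [CommRing R] [Algebra ℂ R] {ε : R →ₐ[ℂ] ℂ}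

lemma sub_algebraMap_mem (ε : R →ₐ[ℂ] ℂ) (x : R) : x - algebraMap ℂ R (ε x) ∈ pointIdeal ε := by
  rw [RingHom.mem_ker, map_sub, AlgHom.commutes, Algebra.algebraMap_self, RingHom.id_apply,
    sub_self]

instance pointIdeal_isMaximal (ε : R →ₐ[ℂ] ℂ) : (pointIdeal ε).IsMaximal :=
  RingHom.ker_isMaximal_of_surjective _ fun c => ⟨algebraMap ℂ R c, by simp⟩

/-- The derivation at the point `ε` attached to a tangent vector. -/
def tangentDer (v : TangentSpace ε) (x : R) : ℂ :=
  v ((pointIdeal ε).toCotangent ⟨x - algebraMap ℂ R (ε x), sub_algebraMap_mem ε x⟩)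

lemma tangentDer_of_mem (v : TangentSpace ε) (x : pointIdeal ε) :
    tangentDer v x = v ((pointIdeal ε).toCotangent x) := by
  have h : ε x = 0 := x.2
  simp only [tangentDer, h, map_zero, sub_zero]

lemma tangentDer_add (v : TangentSpace ε) (x y : R) :
    tangentDer v (x + y) = tangentDer v x + tangentDer v y := by
  simp only [tangentDer, ← map_add]
  congr 2
  ext
  simp only [map_add, Submodule.coe_add]
  ring

lemma tangentDer_algebraMap (v : TangentSpace ε) (c : ℂ) : tangentDer v (algebraMap ℂ R c) = 0 := by
  have : (⟨algebraMap ℂ R c - algebraMap ℂ R (ε (algebraMap ℂ R c)),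
      sub_algebraMap_mem ε _⟩ : pointIdeal ε) = 0 := by
    ext; simp
  rw [tangentDer, this, map_zero, map_zero]

lemma tangentDer_mul (v : TangentSpace ε) (x y : R) :
    tangentDer v (x * y) = ε x * tangentDer v y + ε y * tangentDer v x := by
  have hsm (c : ℂ) (z : pointIdeal ε) :
      c * v ((pointIdeal ε).toCotangent z) =
        v ((pointIdeal ε).toCotangent (algebraMap ℂ R c • z)) := by
    rw [algebraMap_smul, ← smul_eq_mul, ← v.map_smul]
    exact congrArg v (((pointIdeal ε).toCotangent.restrictScalars ℂ).map_smul c z).symm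
  simp only [tangentDer]
  rw [hsm, hsm, ← map_add, ← map_add]
  congr 1
  rw [Ideal.toCotangent_eq]
  have : x * y - algebraMap ℂ R (ε (x * y)) -
      (algebraMap ℂ R (ε x) * (y - algebraMap ℂ R (ε y)) +
        algebraMap ℂ R (ε y) * (x - algebraMap ℂ R (ε x))) =
      (x - algebraMap ℂ R (ε x)) * (y - algebraMap ℂ R (ε y)) := by
    simp only [map_mul]
    ring
  change x * y - algebraMap ℂ R (ε (x * y)) -
      (algebraMap ℂ R (ε x) * (y - algebraMap ℂ R (ε y)) +
        algebraMap ℂ R (ε y) * (x - algebraMap ℂ R (ε x))) ∈ _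
  rw [this, pow_two]
  exact Ideal.mul_mem_mul (sub_algebraMap_mem ε x) (sub_algebraMap_mem ε y)

lemma tangent_eq_zero_of_adjoin {S : Set R} (hS : Algebra.adjoin ℂ S = ⊤) {v : TangentSpace ε}
    (hv : ∀ s ∈ S, tangentDer v s = 0) : v = 0 := by
  have h (x : R) : tangentDer v x = 0 := by
    have hx : x ∈ Algebra.adjoin ℂ S := hS ▸ Algebra.mem_top
    induction hx using Algebra.adjoin_induction with
    | mem x hx => exact hv x hx
    | algebraMap r => exact tangentDer_algebraMap v r
    | add x y _ _ hx hy => rw [tangentDer_add, hx, hy, add_zero]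
    | mul x y _ _ hx hy => rw [tangentDer_mul, hx, hy, mul_zero, mul_zero, add_zero]
  refine LinearMap.ext fun c => ?_
  obtain ⟨x, rfl⟩ := (pointIdeal ε).toCotangent_surjective c
  rw [← tangentDer_of_mem, h, LinearMap.zero_apply]

/-- A linear form on the maximal ideal which kills its square is a tangent vector. -/
lemma exists_tangent (δ : pointIdeal ε →ₗ[ℂ] ℂ)
    (hδ : ∀ x : pointIdeal ε, (x : R) ∈ pointIdeal ε ^ 2 → δ x = 0) :
    ∃ v : TangentSpace ε, ∀ x, v ((pointIdeal ε).toCotangent x) = δ x := by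
  set π := (pointIdeal ε).toCotangent.restrictScalars ℂ with hπ
  have hsurj : Function.Surjective π := (pointIdeal ε).toCotangent_surjective
  have hker : LinearMap.ker π ≤ LinearMap.ker δ := fun x hx =>
    hδ x (((pointIdeal ε).toCotangent_eq_zero x).1 hx)
  refine ⟨(LinearMap.ker π).liftQ δ hker ∘ₗ
    (π.quotKerEquivOfSurjective hsurj).symm.toLinearMap, fun x => ?_⟩
  have : (π.quotKerEquivOfSurjective hsurj).symm (π x) = (LinearMap.ker π).mkQ x := by
    rw [LinearEquiv.symm_apply_eq]
    rfl
  change (LinearMap.ker π).liftQ δ hker ((π.quotKerEquivOfSurjective hsurj).symm (π x)) = _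
  rw [this]
  simp

lemma localDim_le {X : Type*} [TopologicalSpace X] {x : X} {U : Set X} (hU : IsOpen U)
    (hx : x ∈ U) : localDim x ≤ topologicalKrullDim U :=
  iInf₂_le (⟨U, hU⟩ : Opens X) hx

lemma localDim_nonneg {X : Type*} [TopologicalSpace X] (x : X) : 0 ≤ localDim x := by
  refine le_iInf₂ fun U hx => ?_
  have : Nonempty (IrreducibleCloseds U) :=
    ⟨⟨closure {⟨x, hx⟩}, isIrreducible_singleton.closure, isClosed_closure⟩⟩
  exact Order.krullDim_nonneg

lemma notMem_of_sub_one_mem {r : R} (hr : r - 1 ∈ pointIdeal ε) : r ∉ pointIdeal ε := fun hmem =>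
  (Ideal.ne_top_iff_one _).1 (pointIdeal_isMaximal ε).ne_top (by
    rw [← sub_sub_cancel r 1]
    exact sub_mem hmem hr)

/-- If the maximal ideal of a point is idempotent, the point is isolated. -/
lemma localDim_eq_zero [IsNoetherianRing R] (h : pointIdeal ε ≤ pointIdeal ε ^ 2) :
    localDim (toSpec ε) = 0 := by
  refine le_antisymm ?_ (localDim_nonneg _)
  have hfg : (pointIdeal ε).FG := IsNoetherian.noetherian _
  -- By Nakayama, some `r` equal to `1` at the point kills the maximal ideal, so `D(r)` is the point
  -- alone.
  obtain ⟨r, hr, hr'⟩ := Submodule.exists_sub_one_mem_and_smul_eq_zero_of_fg_of_le_smul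
    (pointIdeal ε) (pointIdeal ε) hfg (by rwa [smul_eq_mul, ← pow_two])
  have hrm : r ∉ pointIdeal ε := notMem_of_sub_one_mem hr
  have hU : (basicOpen r : Set (PrimeSpectrum R)) ⊆ {toSpec ε} := by
    intro Q hQ
    have hle : pointIdeal ε ≤ Q.asIdeal := fun x hx => by
      have h0 : r * x = 0 := hr' x hx
      exact (Q.2.mem_or_mem (h0 ▸ Q.asIdeal.zero_mem : r * x ∈ Q.asIdeal)).resolve_left hQ
    exact PrimeSpectrum.ext ((pointIdeal_isMaximal ε).eq_of_le Q.2.ne_top hle).symm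
  have hss : Subsingleton (basicOpen r : Set (PrimeSpectrum R)) :=
    Set.subsingleton_coe _ |>.2 (Set.subsingleton_singleton.anti hU)
  refine (localDim_le (basicOpen r).2 (show toSpec ε ∈ _ from hrm)).trans ?_
  have : Subsingleton (IrreducibleCloseds (basicOpen r : Set (PrimeSpectrum R))) :=
    ⟨fun a b => SetLike.ext' (by
      obtain ⟨x, hx⟩ := a.isIrreducible.nonempty
      obtain ⟨y, hy⟩ := b.isIrreducible.nonempty
      ext z
      rw [Subsingleton.elim z x]
      exact iff_of_true hx (Subsingleton.elim y x ▸ hy))⟩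
  exact Order.krullDim_nonpos_of_subsingleton

/-- A point lying on a proper specialization has dimension at least one. -/
lemma one_le_localDim {A : Type*} [CommRing A] {P Q : PrimeSpectrum A} (h : P < Q) : 1 ≤ localDim Q := by
  refine le_iInf₂ fun U hQ => ?_
  have hsp : P ⤳ Q := (le_iff_specializes P Q).1 h.le
  have hP : P ∈ U := hsp.mem_open U.2 hQ
  let a : IrreducibleCloseds U :=
    ⟨closure {⟨Q, hQ⟩}, isIrreducible_singleton.closure, isClosed_closure⟩
  let b : IrreducibleCloseds U :=
    ⟨closure {⟨P, hP⟩}, isIrreducible_singleton.closure, isClosed_closure⟩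
  have hsp' : (⟨P, hP⟩ : U) ⤳ ⟨Q, hQ⟩ := Topology.IsInducing.subtypeVal.specializes_iff.1 hsp
  have hab : a < b := by
    refine lt_of_le_of_ne ?_ fun hab => h.ne ?_
    · exact specializes_iff_closure_subset.1 hsp'
    · have : (⟨P, hP⟩ : U) ∈ closure {(⟨Q, hQ⟩ : U)} := by
        have h1 : (⟨P, hP⟩ : U) ∈ (b : Set U) := subset_closure rfl
        rw [← hab] at h1
        exact h1
      exact congrArg Subtype.val ((specializes_iff_mem_closure.2 this).antisymm hsp').eq.symm
  exact Order.one_le_krullDim_iff.2 ⟨a, b, hab⟩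

lemma topologicalKrullDim_le_of_subset_range {X Y : Type*} [TopologicalSpace X]
    [TopologicalSpace Y] {g : Y → X} (hg : Topology.IsInducing g) {U : Set X}
    (hU : U ⊆ Set.range g) : topologicalKrullDim U ≤ topologicalKrullDim Y := by
  choose f hf using fun u : U => hU u.2
  have hcomp : g ∘ f = Subtype.val := funext hf
  have hcont : Continuous f := hg.continuous_iff.2 (hcomp ▸ continuous_subtype_val)
  exact (Topology.IsInducing.of_comp hcont hg.continuous
    (hcomp ▸ Topology.IsInducing.subtypeVal)).topologicalKrullDim_le

/-- If an ideal vanishes near a point, the dimension at the point is at most that of the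
quotient. -/
lemma localDim_le_ringKrullDim_quotient {P : Ideal R} {r : R} (hr : r ∉ pointIdeal ε)
    (hP : ∀ x ∈ P, r * x = 0) : localDim (toSpec ε) ≤ ringKrullDim (R ⧸ P) := by
  rw [← topologicalKrullDim_eq_ringKrullDim]
  refine (localDim_le (basicOpen r).2 (show toSpec ε ∈ _ from hr)).trans
    (topologicalKrullDim_le_of_subset_range
      (isClosedEmbedding_comap_of_surjective _ _ (Ideal.Quotient.mk_surjective (I := P))).isInducing
        fun Q hQ => ?_)
  rw [range_comap_of_surjective _ _ Ideal.Quotient.mk_surjective, Ideal.mk_ker]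
  exact fun x hx =>
    (Q.2.mem_or_mem (hP x hx ▸ Q.asIdeal.zero_mem : r * x ∈ Q.asIdeal)).resolve_left hQ

/-- Distinct comparable primes cannot lie over the same prime, so chains remain strict after
contraction. -/
lemma ringKrullDim_le_of_quasiFinite (S T : Type*) [CommRing S] [CommRing T] [Algebra S T]
    [Algebra.QuasiFinite S T] : ringKrullDim T ≤ ringKrullDim S := by
  refine Order.krullDim_le_of_strictMono (comap (algebraMap S T)) fun P Q hPQ => ?_
  refine lt_of_le_of_ne (Ideal.comap_mono hPQ.le) fun h => hPQ.ne ?_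
  exact PrimeSpectrum.ext (Algebra.QuasiFinite.eq_of_le_of_under_eq (R := S) P.asIdeal Q.asIdeal
    hPQ.le (congrArg PrimeSpectrum.asIdeal h))

/-- If, near a point, `d` functions cut out a power of the maximal ideal, the dimension at the point
is at most `d`. -/
lemma localDim_le_of_pow_le [Algebra.FiniteType ℂ R] {d : ℕ} (x : Fin d → R)
    (hx : ∀ i, x i ∈ pointIdeal ε) (k : ℕ)
    (h : pointIdeal ε ^ k ≤ Ideal.span (Set.range x) ⊔ pointIdeal ε ^ (k + 1)) :
    localDim (toSpec ε) ≤ d := by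
  have : IsNoetherianRing R := Algebra.FiniteType.isNoetherianRing ℂ R
  -- By Nakayama, `r m ^ k` lies in the ideal of the `x i`: on `D(r)` they vanish together only at
  -- the point.
  obtain ⟨r, hr, hrle⟩ := Submodule.exists_sub_one_mem_and_smul_le_of_fg_of_le_sup
    (I := pointIdeal ε) (N := Ideal.span (Set.range x)) (N' := pointIdeal ε ^ k)
    (P := pointIdeal ε ^ k) (IsNoetherian.noetherian _) le_rfl
    (by rwa [smul_eq_mul, ← pow_succ'])
  have hrm : r ∉ pointIdeal ε := notMem_of_sub_one_mem hr
  let S := MvPolynomial (Fin d) ℂ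
  let : Algebra S R := (MvPolynomial.aeval x).toRingHom.toAlgebra
  have hX (i : Fin d) : algebraMap S R (MvPolynomial.X i) = x i := MvPolynomial.aeval_X x i
  have : IsScalarTower ℂ S R := IsScalarTower.of_algebraMap_eq fun c =>
    ((MvPolynomial.aeval x).commutes c).symm
  have : Algebra.FiniteType S R := .of_restrictScalars_finiteType ℂ S R
  -- The point is thus isolated in its fibre over affine `d`-space.
  have hqf : Algebra.QuasiFiniteAt S (toSpec ε).asIdeal := by
    refine Algebra.QuasiFiniteAt.of_isOpen_singleton_fiber (toSpec ε) ?_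
    refine ⟨basicOpen r, (basicOpen r).2, ?_⟩
    ext ⟨Q, hQ⟩
    simp only [Set.mem_preimage, Set.mem_singleton_iff]
    constructor
    · intro hrQ
      have hxQ (i : Fin d) : x i ∈ Q.asIdeal := by
        have h1 : MvPolynomial.X i ∈ ((toSpec ε).comap (algebraMap S R)).asIdeal := by
          change algebraMap S R _ ∈ pointIdeal ε
          rw [hX]
          exact hx i
        rw [← show Q.comap (algebraMap S R) = (toSpec ε).comap (algebraMap S R) from hQ] at h1
        change algebraMap S R _ ∈ Q.asIdeal at h1
        rwa [hX] at h1
      have hI : Ideal.span (Set.range x) ≤ Q.asIdeal := Ideal.span_le.2 (by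
        rintro _ ⟨i, rfl⟩
        exact hxQ i)
      have hle : pointIdeal ε ^ k ≤ Q.asIdeal := fun y hy =>
        (Q.2.mem_or_mem (hI (hrle (Submodule.smul_mem_pointwise_smul y r _ hy)) :
          r * y ∈ Q.asIdeal)).resolve_left hrQ
      exact Subtype.ext (PrimeSpectrum.ext
        ((pointIdeal_isMaximal ε).eq_of_le Q.2.ne_top (Q.2.le_of_pow_le hle)).symm)
    · intro h
      obtain rfl : Q = toSpec ε := congrArg Subtype.val h
      exact hrm
  -- By Zariski's main theorem a neighbourhood of the point is open in a finite scheme over affine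
  -- `d`-space, so its dimension is at most `d`.
  obtain ⟨S', hS', f, hf, H⟩ := (Algebra.ZariskisMainProperty.of_finiteType (R := S)
    (toSpec ε).asIdeal).exists_fg_and_exists_notMem_and_awayMap_bijective
  have : Module.Finite S S' := ⟨(Submodule.fg_top _).mpr hS'⟩
  have : Algebra.QuasiFinite S (Localization.Away f) := .trans _ S' _
  have : Algebra.QuasiFinite S (Localization.Away f.1) :=
    .of_surjective_algHom (S := Localization.Away f) (Localization.awayMapₐ S'.val f)
      (show Function.Surjective (Localization.awayMapₐ S'.val f) from H.2)
  calc localDim (toSpec ε) ≤ topologicalKrullDim (basicOpen f.1 : Set (PrimeSpectrum R)) :=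
        localDim_le (basicOpen f.1).2 hf
    _ ≤ topologicalKrullDim (PrimeSpectrum (Localization.Away f.1)) :=
        topologicalKrullDim_le_of_subset_range
          (localization_away_isOpenEmbedding (Localization.Away f.1) f.1).isInducing
          (localization_away_comap_range (Localization.Away f.1) f.1).ge
    _ = ringKrullDim (Localization.Away f.1) := topologicalKrullDim_eq_ringKrullDim _
    _ ≤ ringKrullDim S := ringKrullDim_le_of_quasiFinite _ _
    _ = d := by simp [S]

end LocalGeometry

/-! ### Homology classes -/

section HomologyClasses

open TensorProduct

variable {Γ : Type} [Group Γ]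

lemma homologyClass_mul (x y : Γ) :
    homologyClass (x * y) = homologyClass x + homologyClass y := by
  simp only [homologyClass, map_mul, ofMul_mul, map_add, LinearMap.add_apply]

lemma homologyClass_inv (x : Γ) : homologyClass x⁻¹ = -homologyClass x := by
  simp only [homologyClass, map_inv, ofMul_inv, map_neg, LinearMap.neg_apply]

/-- The class of a `1`-chain. -/
def chainClass (Γ : Type) [Group Γ] : (Γ →₀ ℂ) →ₗ[ℂ] H₁ Γ :=
  (groupHomology.H1π (Rep.trivial ℂ Γ ℂ)).hom ∘ₗ
    (groupHomology.cycles₁IsoOfIsTrivial (Rep.trivial ℂ Γ ℂ)).inv.hom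

lemma chainClass_single (γ : Γ) (c : ℂ) :
    chainClass Γ (Finsupp.single γ c) = c • homologyClass γ := by
  have h : homologyClass γ = chainClass Γ (Finsupp.single γ 1) := rfl
  rw [h, ← map_smul, Finsupp.smul_single, smul_eq_mul, mul_one]

lemma chainClass_surjective : Function.Surjective (chainClass Γ) := by
  have h1 : Function.Surjective (groupHomology.H1π (Rep.trivial ℂ Γ ℂ)).hom :=
    (ModuleCat.epi_iff_surjective _).1 inferInstance
  have h2 : Function.Surjective
      (groupHomology.cycles₁IsoOfIsTrivial (Rep.trivial ℂ Γ ℂ)).inv.hom :=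
    (ModuleCat.epi_iff_surjective _).1 inferInstance
  exact h1.comp h2

lemma span_homologyClass : Submodule.span ℂ (Set.range (homologyClass (Γ := Γ))) = ⊤ := by
  refine eq_top_iff.2 fun x _ => ?_
  obtain ⟨y, rfl⟩ := chainClass_surjective x
  induction y using Finsupp.induction_linear with
  | zero => simp
  | add f g hf hg => rw [map_add]; exact add_mem (hf trivial) (hg trivial)
  | single γ c =>
    rw [chainClass_single]
    exact Submodule.smul_mem _ _ (Submodule.subset_span ⟨γ, rfl⟩)

/-- Additive characters of `Γ` extend to linear forms on the homology. -/
lemma exists_linear_homologyClass (f : Γ →* Multiplicative ℂ) :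
    ∃ L : H₁ Γ →ₗ[ℂ] ℂ, ∀ γ, L (homologyClass γ) = (f γ).toAdd := by
  let f' : Additive (Abelianization Γ) →+ ℂ := MonoidHom.toAdditiveLeft (Abelianization.lift f)
  let g : Additive (Abelianization Γ) ⊗[ℤ] ℂ →ₗ[ℤ] ℂ :=
    TensorProduct.lift ((LinearMap.mul ℤ ℂ).comp f'.toIntLinearMap)
  let L₀ : H₁ Γ →+ ℂ := g.toAddMonoidHom.comp
    (groupHomology.H1AddEquivOfIsTrivial (Rep.trivial ℂ Γ ℂ)).toAddMonoidHom
  have hL₀ (γ : Γ) (c : ℂ) : L₀ (chainClass Γ (Finsupp.single γ c)) = (f γ).toAdd * c := by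
    have := groupHomology.H1AddEquivOfIsTrivial_single (A := Rep.trivial ℂ Γ ℂ) γ c
    change g (groupHomology.H1AddEquivOfIsTrivial (Rep.trivial ℂ Γ ℂ) _) = _
    exact (congrArg g this).trans rfl
  -- `L₀` comes from an isomorphism of additive groups only; its linearity is checked on chains.
  refine ⟨{ L₀ with map_smul' := fun c x => ?_ }, fun γ => ?_⟩
  · obtain ⟨y, rfl⟩ := chainClass_surjective x
    change L₀ _ = c * L₀ _
    induction y using Finsupp.induction_linear with
    | zero => simp
    | add f g hf hg => rw [map_add, smul_add, map_add, map_add, hf, hg, mul_add]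
    | single γ a =>
      rw [← map_smul, Finsupp.smul_single, hL₀, hL₀, smul_eq_mul]
      ring
  · exact (hL₀ γ 1).trans (mul_one _)

/-- The additive character of `Γ` given by a linear form on the homology. -/
def charOfLinear (L : H₁ Γ →ₗ[ℂ] ℂ) : Γ →* Multiplicative ℂ :=
  MonoidHom.mk' (fun γ => Multiplicative.ofAdd (L (homologyClass γ))) fun x y => by
    rw [homologyClass_mul, map_add, ofAdd_add]

end HomologyClasses

/-! ### Diagonal deformations of the trivial representation -/

section Diagonal

variable {Γ : Type*} [Group Γ]

/-- A diagonal representation from a pair of mutually inverse characters. -/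
def diagRep {K : Type*} [CommRing K] (f : Γ →* Kˣ) : Γ →* SL(2, K) :=
  MonoidHom.mk' (fun γ => ⟨!![(f γ : K), 0; 0, ((f γ)⁻¹ : Kˣ)], by simp⟩) fun x y => by
    refine Subtype.ext ?_
    change !![((f (x * y) : Kˣ) : K), 0; 0, ((f (x * y))⁻¹ : Kˣ)] =
      !![(f x : K), 0; 0, ((f x)⁻¹ : Kˣ)] * !![(f y : K), 0; 0, ((f y)⁻¹ : Kˣ)]
    simp [mul_comm]

lemma trace_diagRep {K : Type*} [CommRing K] (f : Γ →* Kˣ) (γ : Γ) :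
    (diagRep f γ : Matrix (Fin 2) (Fin 2) K).trace = f γ + ((f γ)⁻¹ : Kˣ) := by
  change Matrix.trace !![(f γ : K), 0; 0, ((f γ)⁻¹ : Kˣ)] = _
  simp [Matrix.trace_fin_two]

/-- The unit `exp (c s)` of `ℂ⟦s⟧`. -/
def expUnit (c : ℂ) : (PowerSeries ℂ)ˣ where
  val := PowerSeries.rescale c (PowerSeries.exp ℂ)
  inv := PowerSeries.rescale (-c) (PowerSeries.exp ℂ)
  val_inv := by simp [PowerSeries.exp_mul_exp_eq_exp_add]
  inv_val := by simp [PowerSeries.exp_mul_exp_eq_exp_add]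

/-- The character `γ ↦ exp (ℓ(γ) s)`. -/
def expChar (f : Γ →* Multiplicative ℂ) : Γ →* (PowerSeries ℂ)ˣ :=
  MonoidHom.mk' (fun γ => expUnit (f γ).toAdd) fun x y => by
    ext1
    simp [expUnit, PowerSeries.exp_mul_exp_eq_exp_add]

/-- The formal arc on the character variety given by the characters
`Tr diag (exp (ℓ s), exp (-ℓ s))`. -/
def expArc (f : Γ →* Multiplicative ℂ) : charRing Γ →ₐ[ℂ] PowerSeries ℂ :=
  (lift (diagRep (expChar f))).comp (charRing Γ).val

lemma expArc_traceFn (f : Γ →* Multiplicative ℂ) (γ : Γ) :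
    expArc f (traceFn γ) = PowerSeries.rescale (f γ).toAdd (PowerSeries.exp ℂ) +
      PowerSeries.rescale (-(f γ).toAdd) (PowerSeries.exp ℂ) :=
  (lift_trace (diagRep (expChar f)) γ).trans (trace_diagRep _ γ)

lemma trivialChar_traceFn (γ : Γ) : trivialChar Γ (traceFn γ) = 2 := by
  have h := (uFn γ).2
  rw [RingHom.mem_ker] at h
  have h2 : trivialChar Γ (traceFn γ - 2) = 0 := h
  rwa [map_sub, map_ofNat, sub_eq_zero] at h2

/-- The traces are even in `s`, so they have no linear term; this passes to the algebra that they
generate. -/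
lemma coeff_expArc (f : Γ →* Multiplicative ℂ) (x : charRing Γ) :
    PowerSeries.coeff 0 (expArc f x) = trivialChar Γ x ∧ PowerSeries.coeff 1 (expArc f x) = 0 := by
  have hx : x ∈ Algebra.adjoin ℂ (Set.range (traceFn (Γ := Γ))) :=
    adjoin_traceFn (Γ := Γ) ▸ Algebra.mem_top
  induction hx using Algebra.adjoin_induction with
  | mem x hx =>
    obtain ⟨γ, rfl⟩ := hx
    rw [trivialChar_traceFn, expArc_traceFn]
    simp only [map_add, PowerSeries.coeff_rescale, PowerSeries.coeff_exp]
    norm_num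
  | algebraMap r =>
    rw [AlgHom.commutes, AlgHom.commutes, PowerSeries.algebraMap_apply, PowerSeries.coeff_C,
      PowerSeries.coeff_C]
    simp
  | add x y _ _ hx hy => simp only [map_add, hx.1, hx.2, hy.1, hy.2, add_zero, and_self]
  | mul x y _ _ hx hy =>
    simp only [map_mul, PowerSeries.coeff_mul, Finset.Nat.antidiagonal_zero,
      Finset.sum_singleton, Finset.Nat.antidiagonal_succ, Finset.sum_cons, Finset.map_singleton,
      hx.1, hy.1, hy.2]
    simp [hx.2]

lemma coeff_two_expArc_uFn (f : Γ →* Multiplicative ℂ) (γ : Γ) :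
    PowerSeries.coeff 2 (expArc f (uFn γ : charRing Γ)) = (f γ).toAdd ^ 2 := by
  have : ((uFn γ : pointIdeal (trivialChar Γ)) : charRing Γ) = traceFn γ - 2 := rfl
  rw [this, map_sub, map_ofNat, expArc_traceFn, ← map_ofNat (PowerSeries.C (R := ℂ)) 2]
  simp [PowerSeries.coeff_rescale, PowerSeries.coeff_exp]
  ring

lemma X_pow_dvd_expArc (f : Γ →* Multiplicative ℂ) {x : charRing Γ}
    (hx : x ∈ pointIdeal (trivialChar Γ)) : (PowerSeries.X : PowerSeries ℂ) ^ 2 ∣ expArc f x := by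
  rw [PowerSeries.X_pow_dvd_iff]
  intro m hm
  interval_cases m
  · rw [(coeff_expArc f x).1]
    exact hx
  · exact (coeff_expArc f x).2

/-- The squares of additive characters are tangent vectors. -/
lemma exists_tangent_sq (f : Γ →* Multiplicative ℂ) :
    ∃ v : TangentSpace (trivialChar Γ), ∀ γ,
      v ((pointIdeal (trivialChar Γ)).toCotangent (uFn γ)) = (f γ).toAdd ^ 2 := by
  obtain ⟨v, hv⟩ := exists_tangent (ε := trivialChar Γ)
    ((PowerSeries.coeff (R := ℂ) 2).comp ((expArc f).toLinearMap.comp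
      ((pointIdeal (trivialChar Γ)).restrictScalars ℂ).subtype)) (by
    intro x hx
    -- The arc sends `m` into `(s²)`, hence `m²` into `(s⁴)`: the coefficient of `s²` is a linear
    -- form on `m / m²`.
    have hle : pointIdeal (trivialChar Γ) ^ 2 ≤
        (Ideal.span {(PowerSeries.X : PowerSeries ℂ) ^ 4}).comap (expArc f) := by
      rw [pow_two, Ideal.mul_le]
      intro a ha b hb
      rw [Ideal.mem_comap, Ideal.mem_span_singleton, map_mul,
        show (PowerSeries.X : PowerSeries ℂ) ^ 4 = PowerSeries.X ^ 2 * PowerSeries.X ^ 2 by ring]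
      exact mul_dvd_mul (X_pow_dvd_expArc f ha) (X_pow_dvd_expArc f hb)
    have h4 := Ideal.mem_span_singleton.1 (hle hx)
    exact PowerSeries.X_pow_dvd_iff.1 h4 2 (by norm_num))
  exact ⟨v, fun γ => (hv _).trans (coeff_two_expArc_uFn f γ)⟩

end Diagonal

/-! ### Quadratic forms as tangent vectors. -/

section QuadraticForms

variable {Γ : Type} [Group Γ]

/-- Every quadratic form on the homology is a tangent vector at the trivial character. -/
lemma exists_tangent_quadraticForm [FiniteDimensional ℂ (H₁ Γ)] (q : QuadraticForm ℂ (H₁ Γ)) :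
    ∃ v : TangentSpace (trivialChar Γ), ∀ γ,
      v ((pointIdeal (trivialChar Γ)).toCotangent (uFn γ)) = q (homologyClass γ) := by
  -- A diagonalization writes `q` as a combination of squares of linear forms, each given by
  -- `exists_tangent_sq`.
  obtain ⟨w, ⟨e⟩⟩ := QuadraticForm.equivalent_weightedSumSquares q
  choose v hv using fun i => exists_tangent_sq (charOfLinear (LinearMap.proj i ∘ₗ e.toLinearMap))
  refine ⟨∑ i, w i • v i, fun γ => ?_⟩
  rw [LinearMap.sum_apply, ← e.map_app, QuadraticMap.weightedSumSquares_apply]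
  refine Finset.sum_congr rfl fun i _ => ?_
  rw [LinearMap.smul_apply, hv]
  simp [charOfLinear, pow_two]

end QuadraticForms

/-! ### Curves through a smooth point. -/

section Smooth

variable {R : Type*} [CommRing R] [Algebra ℂ R] {ε : R →ₐ[ℂ] ℂ}

lemma toCotangent_mul (r : R) (x : pointIdeal ε) :
    (pointIdeal ε).toCotangent (r • x) = ε r • (pointIdeal ε).toCotangent x := by
  have h : ε r • (pointIdeal ε).toCotangent x =
      (pointIdeal ε).toCotangent (algebraMap ℂ R (ε r) • x) := by
    rw [algebraMap_smul]
    exact (((pointIdeal ε).toCotangent.restrictScalars ℂ).map_smul (ε r) x).symm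
  rw [h, Ideal.toCotangent_eq, pow_two]
  have : (r • x : pointIdeal ε) - (algebraMap ℂ R (ε r) • x : pointIdeal ε) =
      (r - algebraMap ℂ R (ε r)) * (x : R) := by
    rw [sub_mul]
    rfl
  rw [this]
  exact Ideal.mul_mem_mul (sub_algebraMap_mem ε r) x.2

lemma finite_cotangent [IsNoetherianRing R] (ε : R →ₐ[ℂ] ℂ) :
    Module.Finite ℂ (pointIdeal ε).Cotangent := by
  classical
  have : Module.Finite R (pointIdeal ε) := inferInstance
  obtain ⟨S, hS⟩ := this.fg_top
  refine ⟨⟨S.image (pointIdeal ε).toCotangent, eq_top_iff.2 fun c _ => ?_⟩⟩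
  obtain ⟨x, rfl⟩ := (pointIdeal ε).toCotangent_surjective c
  have hx : x ∈ Submodule.span R (S : Set (pointIdeal ε)) := hS ▸ trivial
  induction hx using Submodule.span_induction with
  | zero => simp
  | add x y _ _ hx hy => rw [map_add]; exact add_mem (hx trivial) (hy trivial)
  | smul r x _ hx => rw [toCotangent_mul]; exact Submodule.smul_mem _ _ (hx trivial)
  | mem x hx => exact Submodule.subset_span (Finset.mem_coe.2 (Finset.mem_image_of_mem _ hx))

/-- Modulo `I`, the ideal `m` is generated by `z` up to `m ^ 2`; hence `m ^ k` is generated by `z ^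
k` up to `m ^ (k + 1)`. -/
lemma pow_le_span_sup {A : Type*} [CommRing A] {m I : Ideal A} {z : A} (hz : z ∈ m)
    (hm : m ≤ Ideal.span {z} ⊔ (I ⊔ m ^ 2)) (k : ℕ) :
    m ^ k ≤ Ideal.span {z ^ k} ⊔ (I ⊔ m ^ (k + 1)) := by
  induction k with
  | zero => simp
  | succ k ih =>
    have h1 : m * Ideal.span {z ^ k} ≤ Ideal.span {z ^ (k + 1)} ⊔ (I ⊔ m ^ (k + 2)) := by
      refine (Ideal.mul_mono_left hm).trans ?_
      rw [Ideal.sup_mul, Ideal.sup_mul, Ideal.span_singleton_mul_span_singleton, ← pow_succ']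
      refine sup_le_sup_left (sup_le_sup Ideal.mul_le_left ?_) _
      rw [add_comm k 2, pow_add]
      exact Ideal.mul_mono_right ((Ideal.span_singleton_le_iff_mem _).2 (Ideal.pow_mem_pow hz k))
    have h2 : m * I ≤ Ideal.span {z ^ (k + 1)} ⊔ (I ⊔ m ^ (k + 2)) :=
      Ideal.mul_le_right.trans (le_sup_left.trans le_sup_right)
    have h3 : m ^ (k + 2) ≤ Ideal.span {z ^ (k + 1)} ⊔ (I ⊔ m ^ (k + 2)) :=
      le_sup_right.trans le_sup_right
    rw [pow_succ' m k]
    refine (Ideal.mul_mono_right ih).trans ?_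
    rw [Ideal.mul_sup, Ideal.mul_sup, ← pow_succ' m (k + 1)]
    exact sup_le h1 (sup_le h2 h3)

/-- At a smooth point, every nonzero tangent vector `v` is tangent to a subscheme whose formal
neighbourhood of the point is a smooth curve. -/
lemma exists_curve_of_isSmoothAt [Algebra.FiniteType ℂ R] (hs : IsSmoothAt ε)
    {v : TangentSpace ε} {z : pointIdeal ε} (hz : v ((pointIdeal ε).toCotangent z) = 1) :
    ∃ I : Ideal R, I ≤ pointIdeal ε ∧
      (∀ a : pointIdeal ε, (a : R) - v ((pointIdeal ε).toCotangent a) • (z : R) ∈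
        I ⊔ pointIdeal ε ^ 2) ∧
      ∀ k, (z : R) ^ k ∉ I ⊔ pointIdeal ε ^ (k + 1) := by
  have : IsNoetherianRing R := Algebra.FiniteType.isNoetherianRing ℂ R
  have := finite_cotangent ε
  have hv0 : v ≠ 0 := by
    rintro rfl
    simp at hz
  -- The equations of the curve are lifts of a basis of the cotangent vectors killed by `v`, one
  -- fewer than the dimension of the tangent space.
  let b := Module.finBasis ℂ (LinearMap.ker v)
  choose x hx using fun i => (pointIdeal ε).toCotangent_surjective (b i : (pointIdeal ε).Cotangent)
  set I : Ideal R := Ideal.span (Set.range fun i => (x i : R)) with hI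
  have hIm : I ≤ pointIdeal ε := Ideal.span_le.2 (by
    rintro _ ⟨i, rfl⟩
    exact (x i).2)
  have hmod (a : pointIdeal ε) : (a : R) - v ((pointIdeal ε).toCotangent a) • (z : R) ∈
      I ⊔ pointIdeal ε ^ 2 := by
    set c := v ((pointIdeal ε).toCotangent a) with hc
    have hsm (c : ℂ) (y : pointIdeal ε) : (pointIdeal ε).toCotangent (c • y) =
        c • (pointIdeal ε).toCotangent y :=
      ((pointIdeal ε).toCotangent.restrictScalars ℂ).map_smul c y
    have hker : (pointIdeal ε).toCotangent (a - c • z) ∈ LinearMap.ker v := by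
      rw [LinearMap.mem_ker, map_sub, hsm, map_sub, map_smul, hz, ← hc]
      simp
    have hsum := congrArg Subtype.val (b.sum_repr ⟨_, hker⟩)
    simp only [Submodule.coe_sum, Submodule.coe_smul, ← hx, ← hsm, ← map_sum] at hsum
    have hsq := (pointIdeal ε).toCotangent_eq.1 hsum.symm
    have hsumI : ((∑ i, b.repr ⟨_, hker⟩ i • x i : pointIdeal ε) : R) ∈ I := by
      rw [Submodule.coe_sum]
      refine sum_mem fun i _ => ?_
      change b.repr ⟨_, hker⟩ i • (x i : R) ∈ I
      rw [Algebra.smul_def]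
      exact I.mul_mem_left _ (Ideal.subset_span ⟨i, rfl⟩)
    have := add_mem (Ideal.mem_sup_left (T := pointIdeal ε ^ 2) hsumI)
      (Ideal.mem_sup_right (S := I) hsq)
    rw [add_sub_cancel] at this
    exact this
  refine ⟨I, hIm, hmod, fun k hk => ?_⟩
  have hm : pointIdeal ε ≤ Ideal.span {(z : R)} ⊔ (I ⊔ pointIdeal ε ^ 2) := fun a ha => by
    rw [← sub_add_cancel a (v ((pointIdeal ε).toCotangent ⟨a, ha⟩) • (z : R))]
    refine add_mem (Ideal.mem_sup_right (hmod ⟨a, ha⟩)) (Ideal.mem_sup_left ?_)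
    rw [Algebra.smul_def]
    exact Ideal.mul_mem_left _ _ (Ideal.mem_span_singleton_self _)
  -- If `z ^ k` were in the ideal, these equations alone would cut out a power of `m` near the
  -- point, making the local dimension too small.
  have hle : pointIdeal ε ^ k ≤ I ⊔ pointIdeal ε ^ (k + 1) :=
    (pow_le_span_sup z.2 hm k).trans (sup_le ((Ideal.span_singleton_le_iff_mem _).2 hk) le_rfl)
  have hdim := localDim_le_of_pow_le (ε := ε) (fun i => (x i : R)) (fun i => (x i).2) k hle
  have hfr : Module.finrank ℂ (LinearMap.ker v) + 1 = Module.finrank ℂ (pointIdeal ε).Cotangent :=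
    Module.Dual.finrank_ker_add_one_of_ne_zero hv0
  rw [IsSmoothAt, ← Module.finrank_eq_rank, Subspace.dual_finrank_eq, ← hfr,
    Cardinal.toENat_nat] at hs
  rw [hs] at hdim
  have h2 : Module.finrank ℂ (LinearMap.ker v) + 1 ≤ Module.finrank ℂ (LinearMap.ker v) := by
    exact_mod_cast hdim
  omega

end Smooth

/-! ### Trace identities -/

section TraceIdentities

variable {A : Type*} [CommRing A]

/-- The coordinates of the trace-free part of a matrix. -/
def pureCoords (X : Fin 3 → Matrix (Fin 2) (Fin 2) A) : Matrix (Fin 3) (Fin 3) A :=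
  Matrix.of fun i => ![X i 0 0 - X i 1 1, X i 0 1, X i 1 0]

lemma det_pureCoords (X : Fin 3 → Matrix (Fin 2) (Fin 2) A) :
    (pureCoords X).det = (X 0 * X 1 * X 2).trace - (X 0 * X 2 * X 1).trace := by
  simp [pureCoords, Matrix.det_fin_three, Matrix.trace_fin_two, Matrix.mul_apply, Fin.sum_univ_two]
  ring

/-- The entries are `2 Tr(X₀ Y₀)`, with `X₀` and `Y₀` the trace-free parts. In the coordinates
`pureCoords` this is the bilinear form `aa' + 2bc' + 2cb'`, of determinant `-4`. -/
lemma det_trace_form (X Y : Fin 3 → Matrix (Fin 2) (Fin 2) A) :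
    (Matrix.of fun i j => (X i * Y j).trace - (X i * (Y j).adjugate).trace).det =
      -4 * (pureCoords X).det * (pureCoords Y).det := by
  have h : (Matrix.of fun i j => (X i * Y j).trace - (X i * (Y j).adjugate).trace) =
      pureCoords X * !![1, 0, 0; 0, 0, 2; 0, 2, 0] * (pureCoords Y).transpose := by
    ext i j
    simp [pureCoords, Matrix.mul_apply, Fin.sum_univ_two, Fin.sum_univ_three,
      Matrix.trace_fin_two, Matrix.adjugate_fin_two]
    ring
  rw [h, Matrix.det_mul, Matrix.det_mul, Matrix.det_transpose]
  simp [Matrix.det_fin_three]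
  ring

lemma trace_mul_add_trace_mul_adjugate (X Y : Matrix (Fin 2) (Fin 2) A) :
    (X * Y).trace + (X * Y.adjugate).trace = X.trace * Y.trace := by
  simp [Matrix.mul_apply, Fin.sum_univ_two, Matrix.trace_fin_two, Matrix.adjugate_fin_two]
  ring

variable {Γ : Type*} [Group Γ]

lemma coe_traceFn (γ : Γ) : (traceFn γ : RepRing Γ) =
    (univRep Γ γ : Matrix (Fin 2) (Fin 2) (RepRing Γ)).trace := rfl

lemma traceFn_one : traceFn (1 : Γ) = 2 := by
  refine Subtype.ext ?_
  rw [coe_traceFn, map_one, Matrix.SpecialLinearGroup.coe_one, Matrix.trace_one]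
  exact Nat.cast_ofNat

lemma traceFn_mul_comm (x y : Γ) : traceFn (x * y) = traceFn (y * x) := by
  refine Subtype.ext ?_
  rw [coe_traceFn, coe_traceFn, map_mul, map_mul, Matrix.SpecialLinearGroup.coe_mul,
    Matrix.SpecialLinearGroup.coe_mul, Matrix.trace_mul_comm]

lemma traceFn_mul_add (x y : Γ) :
    traceFn (x * y) + traceFn (x * y⁻¹) = traceFn x * traceFn y := by
  refine Subtype.ext ?_
  have := trace_mul_add_trace_mul_adjugate
    (univRep Γ x : Matrix (Fin 2) (Fin 2) (RepRing Γ)) (univRep Γ y)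
  rw [← Matrix.SpecialLinearGroup.coe_inv, ← Matrix.SpecialLinearGroup.coe_mul,
    ← Matrix.SpecialLinearGroup.coe_mul, ← map_inv, ← map_mul, ← map_mul] at this
  exact this

/-- The function `ρ ↦ 2 Tr (ρ(x)₀ ρ(y)₀)`, where `X₀` is the trace-free part of `X`. -/
def traceForm (x y : Γ) : charRing Γ := traceFn (x * y) - traceFn (x * y⁻¹)

/-- The alternating function `Tr ρ(x₀x₁x₂) - Tr ρ(x₀x₂x₁)`. -/
def traceAlt (x : Fin 3 → Γ) : charRing Γ :=
  traceFn (x 0 * x 1 * x 2) - traceFn (x 0 * x 2 * x 1)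

lemma det_traceForm (x y : Fin 3 → Γ) :
    (Matrix.of fun i j => traceForm (x i) (y j)).det = -4 * traceAlt x * traceAlt y := by
  refine Subtype.ext ?_
  have h := det_trace_form
    (fun i => (univRep Γ (x i) : Matrix (Fin 2) (Fin 2) (RepRing Γ)))
    (fun i => (univRep Γ (y i) : Matrix (Fin 2) (Fin 2) (RepRing Γ)))
  simp only [det_pureCoords, ← Matrix.SpecialLinearGroup.coe_inv,
    ← Matrix.SpecialLinearGroup.coe_mul, ← map_inv, ← map_mul, ← coe_traceFn] at h
  have e : ((Matrix.of fun i j => traceForm (x i) (y j)).det : RepRing Γ) =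
      (Matrix.of fun i j => ((traceFn (x i * y j) : charRing Γ) : RepRing Γ) -
        (traceFn (x i * (y j)⁻¹) : charRing Γ)).det :=
    AlgHom.map_det (charRing Γ).val (Matrix.of fun i j => traceForm (x i) (y j))
  rw [e, h]
  rfl

end TraceIdentities

/-! ### One-dimensional tangent spaces -/

section Curve

variable {R : Type*} [CommRing R] [Algebra ℂ R] {ε : R →ₐ[ℂ] ℂ}

lemma ringKrullDim_quotient_le_one {S : Set R} (hS : Algebra.adjoin ℂ S = ⊤) {P : Ideal R} {x : R}
    (h : ∀ s ∈ S, ∃ t ∈ Algebra.adjoin ℂ {x}, s - t ∈ P) : ringKrullDim (R ⧸ P) ≤ 1 := by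
  set π := Ideal.Quotient.mkₐ ℂ P with hπ
  have hsurj : Function.Surjective (Polynomial.aeval (R := ℂ) (π x)) := by
    rw [← AlgHom.range_eq_top, ← Algebra.adjoin_singleton_eq_range_aeval, eq_top_iff,
      ← (AlgHom.range_eq_top π).2 (Ideal.Quotient.mkₐ_surjective ℂ P), ← Algebra.map_top,
      ← hS, AlgHom.map_adjoin, Algebra.adjoin_le_iff]
    rintro _ ⟨s, hs, rfl⟩
    obtain ⟨t, ht, hst⟩ := h s hs
    have : π t ∈ (Algebra.adjoin ℂ {x}).map π := Subalgebra.mem_map.2 ⟨t, ht, rfl⟩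
    rw [AlgHom.map_adjoin, Set.image_singleton] at this
    rwa [SetLike.mem_coe, show π s = π t from Ideal.Quotient.eq.2 hst]
  refine (ringKrullDim_le_of_surjective (Polynomial.aeval (R := ℂ) (π x)).toRingHom hsurj).trans ?_
  rw [Polynomial.ringKrullDim_of_isNoetherianRing, ringKrullDim_eq_zero_of_field, zero_add]

/-- The tangent space is the line of `v₀`, so by duality `x` spans `m / m²`. -/
lemma pointIdeal_le_span_sup {x : pointIdeal ε} {v₀ : TangentSpace ε}
    (hx : v₀ ((pointIdeal ε).toCotangent x) = 1)
    (hv : ∀ v : TangentSpace ε, v = v ((pointIdeal ε).toCotangent x) • v₀) :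
    pointIdeal ε ≤ Ideal.span {(x : R)} ⊔ pointIdeal ε • pointIdeal ε := fun y hy => by
  set c := v₀ ((pointIdeal ε).toCotangent ⟨y, hy⟩) with hc
  have h0 : (pointIdeal ε).toCotangent ⟨y, hy⟩ - c • (pointIdeal ε).toCotangent x = 0 := by
    refine (Module.forall_dual_apply_eq_zero_iff ℂ _).1 fun v => ?_
    rw [map_sub, map_smul, hv v, LinearMap.smul_apply, LinearMap.smul_apply, hx, ← hc]
    simp only [smul_eq_mul]
    ring
  have hc' : c • (pointIdeal ε).toCotangent x =
      (pointIdeal ε).toCotangent (algebraMap ℂ R c • x) := by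
    rw [toCotangent_mul, AlgHom.commutes]
    rfl
  rw [hc', sub_eq_zero, Ideal.toCotangent_eq, pow_two] at h0
  have := add_mem (Ideal.mem_sup_right (S := Ideal.span {(x : R)}) h0)
    (Ideal.mem_sup_left (Ideal.mul_mem_left _ (algebraMap ℂ R c)
      (Ideal.mem_span_singleton_self (x : R))))
  exact (sub_add_cancel y (algebraMap ℂ R c * x)) ▸ this

/-- A point lying on a curve and having a one-dimensional tangent space is smooth. -/
lemma isSmoothAt_of_prime_of_tangent [IsNoetherianRing R] {P : Ideal R} (hP : P.IsPrime)
    (hPm : P ≤ pointIdeal ε) {x : pointIdeal ε} (hxP : (x : R) ∉ P) {v₀ : TangentSpace ε}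
    (hx : v₀ ((pointIdeal ε).toCotangent x) = 1)
    (hv : ∀ v : TangentSpace ε, v = v ((pointIdeal ε).toCotangent x) • v₀)
    (hdim : ringKrullDim (R ⧸ P) ≤ 1) : IsSmoothAt ε := by
  have hrank : Module.rank ℂ (TangentSpace ε) = 1 :=
    rank_eq_one v₀ (fun h0 => by simp [h0] at hx) fun v => ⟨_, (hv v).symm⟩
  obtain ⟨r, hr, hrm⟩ := Submodule.exists_sub_one_mem_and_smul_le_of_fg_of_le_sup
    (I := pointIdeal ε) (N := Ideal.span {(x : R)}) (N' := pointIdeal ε) (P := pointIdeal ε)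
    (IsNoetherian.noetherian _) le_rfl (pointIdeal_le_span_sup hx hv)
  -- Near the point `m` is generated by `x`. If `x b` is in the prime `P`, which does not contain
  -- `x`, then `b` is in `P`. Hence `P = m P` locally, and Nakayama makes `P` vanish near the point.
  have hPle : P ≤ pointIdeal ε • P := fun p hp => by
    obtain ⟨b, hb⟩ := Ideal.mem_span_singleton.1
      (hrm (Submodule.smul_mem_pointwise_smul p r (pointIdeal ε) (hPm hp)))
    rw [smul_eq_mul] at hb
    have hbP : b ∈ P := by
      have : (x : R) * b ∈ P := hb ▸ P.mul_mem_left r hp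
      exact (hP.mem_or_mem this).resolve_left hxP
    have e : p = x * b - (r - 1) * p := by rw [← hb]; ring
    rw [e, smul_eq_mul]
    exact sub_mem (Ideal.mul_mem_mul x.2 hbP) (Ideal.mul_mem_mul hr hp)
  obtain ⟨s, hs, hsP⟩ := Submodule.exists_sub_one_mem_and_smul_eq_zero_of_fg_of_le_smul
    (pointIdeal ε) P (IsNoetherian.noetherian _) hPle
  rw [IsSmoothAt, hrank, map_one]
  refine le_antisymm ?_ ?_
  · exact (localDim_le_ringKrullDim_quotient (notMem_of_sub_one_mem hs) hsP).trans hdim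
  · refine one_le_localDim (P := ⟨P, hP⟩) (lt_of_le_of_ne hPm fun he => hxP ?_)
    have : P = pointIdeal ε := congrArg PrimeSpectrum.asIdeal he
    rw [this]
    exact x.2

lemma sup_pow_mul_sup_pow_le {A : Type*} [CommRing A] (I m : Ideal A) (a b : ℕ) :
    (I ⊔ m ^ a) * (I ⊔ m ^ b) ≤ I ⊔ m ^ (a + b) := by
  rw [Ideal.sup_mul, Ideal.mul_sup, Ideal.mul_sup, ← pow_add]
  exact sup_le (sup_le (le_sup_of_le_left Ideal.mul_le_left)
    (le_sup_of_le_left Ideal.mul_le_left)) (sup_le (le_sup_of_le_left Ideal.mul_le_right) le_sup_right)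

/-- A tangent vector at a smooth point is the tangent vector of a formal curve with parameter `z`,
here given by the filtration by order of vanishing along the curve. -/
lemma exists_filtration_of_isSmoothAt [Algebra.FiniteType ℂ R] (hs : IsSmoothAt ε)
    {v : TangentSpace ε} {z : pointIdeal ε} (hz : v ((pointIdeal ε).toCotangent z) = 1) :
    ∃ J : ℕ → Ideal R, (∀ a b, J a * J b ≤ J (a + b)) ∧ pointIdeal ε ≤ J 1 ∧
      (∀ a : pointIdeal ε, (a : R) - v ((pointIdeal ε).toCotangent a) • (z : R) ∈ J 2) ∧
      ∀ k, (z : R) ^ k ∉ J (k + 1) := by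
  obtain ⟨I, -, hI, hzk⟩ := exists_curve_of_isSmoothAt hs hz
  refine ⟨fun k => I ⊔ pointIdeal ε ^ k, sup_pow_mul_sup_pow_le _ _, ?_, hI, hzk⟩
  exact (pow_one (pointIdeal ε)).ge.trans le_sup_right

end Curve

/-! ### Small first homology -/

section SmallHomology

variable {Γ : Type} [Group Γ]

lemma tangentDer_traceFn (v : TangentSpace (trivialChar Γ)) (γ : Γ) :
    tangentDer v (traceFn γ) = v ((pointIdeal (trivialChar Γ)).toCotangent (uFn γ)) := by
  rw [← tangentDer_of_mem]
  have h : traceFn γ = (uFn γ : charRing Γ) + algebraMap ℂ (charRing Γ) 2 := by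
    rw [map_ofNat]
    exact (sub_add_cancel _ _).symm
  rw [h, tangentDer_add, tangentDer_algebraMap, add_zero]

/-- If an additive character of `Γ` is determined by its value at `γ₀`, so is a tangent vector by
its value at `u_{γ₀}`. -/
lemma tangent_eq_zero {γ₀ : Γ} (h₀ : ∀ f : Γ →* Multiplicative ℂ, f γ₀ = 1 → f = 1)
    {v : TangentSpace (trivialChar Γ)}
    (hv : v ((pointIdeal (trivialChar Γ)).toCotangent (uFn γ₀)) = 0) : v = 0 := by
  refine tangent_eq_zero_of_adjoin adjoin_traceFn ?_
  -- The derivation rule applied to `t_{xy} + t_{xy⁻¹} = t_x t_y`, with `t = 2` at the trivial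
  -- character, gives the parallelogram law.
  have := parallelogram_eq_zero (φ := fun γ => tangentDer v (traceFn γ))
    (fun x y => by rw [traceFn_mul_comm])
    (fun x y => by
      rw [← tangentDer_add, traceFn_mul_add, tangentDer_mul, trivialChar_traceFn,
        trivialChar_traceFn]
      ring) h₀ (by rw [tangentDer_traceFn, hv])
  rintro _ ⟨γ, rfl⟩
  exact congrFun this γ

lemma finite_H₁ (Γ : Type) [Group Γ] [Group.FG Γ] : Module.Finite ℂ (H₁ Γ) := by
  classical
  obtain ⟨S, hS⟩ := Group.fg_def.1 ‹Group.FG Γ›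
  refine ⟨⟨S.image homologyClass, ?_⟩⟩
  rw [eq_top_iff, ← span_homologyClass, Submodule.span_le]
  rintro _ ⟨γ, rfl⟩
  have hγ : γ ∈ Subgroup.closure (S : Set Γ) := hS ▸ Subgroup.mem_top γ
  induction hγ using Subgroup.closure_induction with
  | mem s hs => exact Submodule.subset_span (Finset.mem_coe.2 (Finset.mem_image_of_mem _ hs))
  | one =>
    have : homologyClass (1 : Γ) = 0 := by
      have := homologyClass_mul (1 : Γ) 1
      rwa [mul_one, left_eq_add] at this
    rw [this]
    exact zero_mem _
  | mul x y _ _ hx hy => rw [homologyClass_mul]; exact add_mem hx hy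
  | inv x _ hx => rw [homologyClass_inv]; exact neg_mem hx

/-- All additive characters are trivial, so `tangent_eq_zero` applies with `γ₀ = 1`, where `u_1 =
0`. Thus `m = m²`. -/
lemma isSmoothAt_of_finrank_eq_zero [Group.FG Γ] (h : Module.finrank ℂ (H₁ Γ) = 0) :
    IsSmoothAt (trivialChar Γ) := by
  have := finite_H₁ Γ
  have hsub : Subsingleton (H₁ Γ) := Module.finrank_zero_iff.1 h
  have hT (v : TangentSpace (trivialChar Γ)) : v = 0 := by
    refine tangent_eq_zero (γ₀ := 1) (fun f _ => ?_) ?_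
    · obtain ⟨L, hL⟩ := exists_linear_homologyClass f
      ext γ
      have := hL γ
      rw [Subsingleton.elim (homologyClass γ) 0, map_zero] at this
      exact congrArg Multiplicative.ofAdd this.symm
    · have : (uFn (1 : Γ)) = 0 := Subtype.ext (by
        change traceFn (1 : Γ) - 2 = 0
        rw [traceFn_one, sub_self])
      rw [this, map_zero, map_zero]
  have : Subsingleton (TangentSpace (trivialChar Γ)) := ⟨fun v w => (hT v).trans (hT w).symm⟩
  have : IsNoetherianRing (charRing Γ) := Algebra.FiniteType.isNoetherianRing ℂ _
  rw [IsSmoothAt, rank_subsingleton', map_zero]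
  refine localDim_eq_zero fun x hx => ?_
  refine ((pointIdeal (trivialChar Γ)).toCotangent_eq_zero ⟨x, hx⟩).1 ?_
  refine (Module.forall_dual_apply_eq_zero_iff ℂ _).1 fun v => ?_
  rw [hT v, LinearMap.zero_apply]

/-- The image of `f` is finitely generated and torsion-free, hence free over `ℤ`; a coordinate of it
is an integral character taking the value `1`. -/
lemma exists_int_character [Group.FG Γ] {f : Γ →* Multiplicative ℂ} (hf : f ≠ 1) :
    ∃ (h : Γ →* Multiplicative ℤ) (γ₀ : Γ), h γ₀ = Multiplicative.ofAdd 1 := by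
  let F : Additive Γ →+ ℂ := MonoidHom.toAdditiveLeft f
  have : Module.Finite ℤ F.range := Module.Finite.iff_addGroup_fg.2 inferInstance
  have hnt : Nontrivial F.range := by
    obtain ⟨γ, hγ⟩ : ∃ γ, f γ ≠ 1 := by
      by_contra! h
      exact hf (MonoidHom.ext h)
    refine ⟨⟨⟨F (Additive.ofMul γ), _, rfl⟩, 0, fun h0 => hγ ?_⟩⟩
    exact congrArg (fun x : F.range => Multiplicative.ofAdd (x : ℂ)) h0
  let b := Module.Free.chooseBasis ℤ F.range
  obtain ⟨i⟩ := b.index_nonempty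
  obtain ⟨γ₀, hγ₀⟩ := (b i).2
  refine ⟨AddMonoidHom.toMultiplicativeRight ((b.coord i).toAddMonoidHom.comp F.rangeRestrict),
    Additive.toMul γ₀, ?_⟩
  have : F.rangeRestrict γ₀ = b i := Subtype.ext hγ₀
  change Multiplicative.ofAdd (b.coord i (F.rangeRestrict γ₀)) = _
  rw [this]
  simp

lemma traceFn_inv (x : Γ) : traceFn x⁻¹ = traceFn x := by
  have := traceFn_mul_add 1 x
  rw [one_mul, one_mul, traceFn_one, two_mul] at this
  exact add_left_cancel this

lemma traceFn_zpow_mem (γ : Γ) (k : ℤ) : traceFn (γ ^ k) ∈ Algebra.adjoin ℂ {traceFn γ} := by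
  have hγ : traceFn γ ∈ Algebra.adjoin ℂ {traceFn γ} := Algebra.subset_adjoin rfl
  have hnat (n : ℕ) : traceFn (γ ^ n) ∈ Algebra.adjoin ℂ {traceFn γ} ∧
      traceFn (γ ^ (n + 1)) ∈ Algebra.adjoin ℂ {traceFn γ} := by
    induction n with
    | zero =>
      refine ⟨?_, by simp⟩
      rw [pow_zero, traceFn_one]
      exact ofNat_mem _ 2
    | succ n ih =>
      refine ⟨ih.2, ?_⟩
      -- The Chebyshev recurrence for traces of powers.
      have := traceFn_mul_add (γ ^ (n + 1)) γ
      rw [← pow_succ, pow_succ γ n, mul_inv_cancel_right, ← pow_succ γ n] at this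
      rw [eq_sub_of_add_eq this]
      exact sub_mem (mul_mem ih.2 hγ) ih.1
  obtain ⟨n, rfl | rfl⟩ := k.eq_nat_or_neg
  · rw [zpow_natCast]
    exact (hnat n).1
  · rw [zpow_neg, zpow_natCast, traceFn_inv]
    exact (hnat n).1

/-- The additive complex character given by an integral one. -/
def intChar (h : Γ →* Multiplicative ℤ) : Γ →* Multiplicative ℂ :=
  (AddMonoidHom.toMultiplicative (Int.castAddHom ℂ)).comp h

lemma intChar_apply (h : Γ →* Multiplicative ℤ) (γ : Γ) :
    (intChar h γ).toAdd = ((h γ).toAdd : ℂ) := rfl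

/-- Since `h` is integral, `γ` and the power `γ₀ ^ h(γ)` have the same trace along the arc, and the
latter is a polynomial in `t_{γ₀}`. The quotient is thus generated by one element. -/
lemma ringKrullDim_quotient_ker_expArc_le {h : Γ →* Multiplicative ℤ} {γ₀ : Γ}
    (hγ₀ : h γ₀ = Multiplicative.ofAdd 1) :
    ringKrullDim (charRing Γ ⧸ RingHom.ker (expArc (intChar h))) ≤ 1 := by
  refine ringKrullDim_quotient_le_one adjoin_traceFn (x := traceFn γ₀) ?_
  rintro _ ⟨γ, rfl⟩
  refine ⟨_, traceFn_zpow_mem γ₀ (h γ).toAdd, ?_⟩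
  rw [RingHom.mem_ker, map_sub, sub_eq_zero]
  have e : (intChar h (γ₀ ^ (h γ).toAdd)).toAdd = (intChar h γ).toAdd := by
    rw [intChar_apply, intChar_apply, map_zpow, hγ₀]
    simp
  exact (expArc_traceFn _ _).trans ((expArc_traceFn _ _).trans (by rw [e])).symm

lemma isSmoothAt_of_finrank_eq_one [Group.FG Γ] (hn : Module.finrank ℂ (H₁ Γ) = 1) :
    IsSmoothAt (trivialChar Γ) := by
  have := finite_H₁ Γ
  have : IsNoetherianRing (charRing Γ) := Algebra.FiniteType.isNoetherianRing ℂ _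
  have : Nontrivial (H₁ Γ) := Module.nontrivial_of_finrank_pos (R := ℂ) (by omega)
  obtain ⟨f, hf⟩ : ∃ f : Γ →* Multiplicative ℂ, f ≠ 1 := by
    by_contra! hall
    obtain ⟨x, hx⟩ := exists_ne (0 : H₁ Γ)
    refine hx ((Module.forall_dual_apply_eq_zero_iff ℂ x).1 fun L => ?_)
    have hL : L = 0 := LinearMap.ext_on_range span_homologyClass fun γ => by
      have := DFunLike.congr_fun (hall (charOfLinear L)) γ
      exact congrArg Multiplicative.toAdd this
    rw [hL, LinearMap.zero_apply]
  obtain ⟨h, γ₀, hγ₀⟩ := exists_int_character hf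
  have hval : (intChar h γ₀).toAdd = 1 := by
    rw [intChar_apply, hγ₀]
    simp
  have hcl : homologyClass γ₀ ≠ 0 := fun h0 => by
    obtain ⟨L, hL⟩ := exists_linear_homologyClass (intChar h)
    have := hL γ₀
    rw [h0, map_zero, hval] at this
    exact zero_ne_one this
  have h₀ (f : Γ →* Multiplicative ℂ) (hfγ : f γ₀ = 1) : f = 1 := by
    obtain ⟨L, hL⟩ := exists_linear_homologyClass f
    ext γ
    obtain ⟨c, hc⟩ := (finrank_eq_one_iff_of_nonzero' _ hcl).1 hn (homologyClass γ)
    have := hL γ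
    rw [← hc, map_smul, hL, hfγ, toAdd_one, smul_zero] at this
    exact congrArg Multiplicative.ofAdd this.symm
  set m := pointIdeal (trivialChar Γ) with hm
  set x := uFn γ₀ with hx
  obtain ⟨v₀, hv₀⟩ := exists_tangent_sq (intChar h)
  have hv₀x : v₀ (m.toCotangent x) = 1 := by rw [hx, hv₀, hval, one_pow]
  have hmul (v : TangentSpace (trivialChar Γ)) : v = v (m.toCotangent x) • v₀ := by
    rw [← sub_eq_zero]
    refine tangent_eq_zero h₀ ?_
    rw [LinearMap.sub_apply, LinearMap.smul_apply, ← hx, hv₀x, smul_eq_mul, mul_one, sub_self]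
  have hPm : RingHom.ker (expArc (intChar h)) ≤ m := fun y hy => by
    have := (coeff_expArc (intChar h) y).1
    rw [(RingHom.mem_ker).1 hy, map_zero] at this
    exact this.symm
  have hxP : (x : charRing Γ) ∉ RingHom.ker (expArc (intChar h)) := fun hxP => by
    have := coeff_two_expArc_uFn (intChar h) γ₀
    rw [← hx, (RingHom.mem_ker).1 hxP, map_zero, hval] at this
    simp at this
  exact isSmoothAt_of_prime_of_tangent (RingHom.ker_isPrime _) hPm hxP hv₀x hmul
    (ringKrullDim_quotient_ker_expArc_le hγ₀)

end SmallHomology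

/-! ### Large first homology -/

section LargeHomology

variable {Γ : Type} [Group Γ]

lemma traceForm_mem (x y : Γ) : traceForm x y ∈ pointIdeal (trivialChar Γ) := by
  rw [RingHom.mem_ker, traceForm, map_sub, sub_eq_zero]
  exact (trivialChar_traceFn _).trans (trivialChar_traceFn _).symm

lemma traceAlt_mem (x : Fin 3 → Γ) : traceAlt x ∈ pointIdeal (trivialChar Γ) := by
  rw [RingHom.mem_ker, traceAlt, map_sub, sub_eq_zero]
  exact (trivialChar_traceFn _).trans (trivialChar_traceFn _).symm

lemma tangent_traceForm (v : TangentSpace (trivialChar Γ)) (x y : Γ) :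
    v ((pointIdeal (trivialChar Γ)).toCotangent ⟨traceForm x y, traceForm_mem x y⟩) =
      v ((pointIdeal (trivialChar Γ)).toCotangent (uFn (x * y))) -
        v ((pointIdeal (trivialChar Γ)).toCotangent (uFn (x * y⁻¹))) := by
  rw [← map_sub, ← map_sub]
  congr 2
  refine Subtype.ext ?_
  change traceFn _ - traceFn _ = (traceFn _ - 2) - (traceFn _ - 2)
  ring

/-- Along a filtration in which `v` becomes a parameter `z` of a smooth curve, the quadratic part of
`v` has rank at most two. -/
lemma det_eq_zero_of_filtration {v : TangentSpace (trivialChar Γ)} {J : ℕ → Ideal (charRing Γ)}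
    (hJmul : ∀ a b, J a * J b ≤ J (a + b)) (hJ1 : pointIdeal (trivialChar Γ) ≤ J 1)
    {z : charRing Γ} (hz : z ∈ J 1)
    (hv : ∀ a : pointIdeal (trivialChar Γ),
      (a : charRing Γ) - v ((pointIdeal (trivialChar Γ)).toCotangent a) • z ∈ J 2)
    (hz2 : z ^ 2 ∉ J 3) (hz3 : z ^ 3 ∉ J 4) (x y : Fin 3 → Γ) :
    (Matrix.of fun i j => v ((pointIdeal (trivialChar Γ)).toCotangent
      ⟨traceForm (x i) (y j), traceForm_mem _ _⟩)).det = 0 := by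
  have hm {a b : ℕ} {s t : charRing Γ} (hs : s ∈ J a) (ht : t ∈ J b) : s * t ∈ J (a + b) :=
    hJmul a b (Ideal.mul_mem_mul hs ht)
  have hsmul {a : ℕ} {c : ℂ} {s : charRing Γ} (hs : s ∈ J a) : c • s ∈ J a := by
    rw [Algebra.smul_def]
    exact (J a).mul_mem_left _ hs
  have hunsmul {a : ℕ} {c : ℂ} (hc : c ≠ 0) {s : charRing Γ} (hs : c • s ∈ J a) : s ∈ J a := by
    rw [← inv_smul_smul₀ hc s]
    exact hsmul hs
  have hmul2 {s t : charRing Γ} {c d : ℂ} (hs : s - c • z ∈ J 2) (ht1 : t ∈ J 1)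
      (ht : t - d • z ∈ J 2) : s * t - (c * d) • z ^ 2 ∈ J 3 := by
    have e : s * t - (c * d) • z ^ 2 = (s - c • z) * t + (c • z) * (t - d • z) := by
      simp only [Algebra.smul_def, map_mul]
      ring
    rw [e]
    exact add_mem (hm hs ht1) (hm (hsmul hz) ht)
  have hmul3 {s t u : charRing Γ} {c d e : ℂ} (hs : s - c • z ∈ J 2) (ht1 : t ∈ J 1)
      (ht : t - d • z ∈ J 2) (hu1 : u ∈ J 1) (hu : u - e • z ∈ J 2) :
      s * t * u - (c * d * e) • z ^ 3 ∈ J 4 := by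
    have e' : s * t * u - (c * d * e) • z ^ 3 =
        (s * t - (c * d) • z ^ 2) * u + ((c * d) • z * z) * (u - e • z) := by
      simp only [Algebra.smul_def, map_mul]
      ring
    rw [e']
    exact add_mem (hm (hmul2 hs ht1 ht) hu1) (hm (hm (hsmul hz) hz) hu)
  have hdet3 (x y : Fin 3 → Γ) : (Matrix.of fun i j => traceForm (x i) (y j)).det ∈ J 3 := by
    have h (i j k l p q : Fin 3) :
        traceForm (x i) (y j) * traceForm (x k) (y l) * traceForm (x p) (y q) ∈ J 3 :=
      hm (hm (hJ1 (traceForm_mem _ _)) (hJ1 (traceForm_mem _ _))) (hJ1 (traceForm_mem _ _))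
    rw [Matrix.det_fin_three]
    simp only [Matrix.of_apply]
    exact sub_mem (add_mem (add_mem (sub_mem (sub_mem (h _ _ _ _ _ _) (h _ _ _ _ _ _))
      (h _ _ _ _ _ _)) (h _ _ _ _ _ _)) (h _ _ _ _ _ _)) (h _ _ _ _ _ _)
  have hfour {a : ℕ} {s t : charRing Γ} (h : -4 * s * t ∈ J a) : s * t ∈ J a := by
    refine hunsmul (c := -4) (by norm_num) ?_
    rw [Algebra.smul_def, map_neg, map_ofNat, ← mul_assoc]
    exact h
  -- Its square has order at least three, which excludes order one because `z ^ 2 ∉ J 3`.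
  have halt (x : Fin 3 → Γ) : traceAlt x ∈ J 2 := by
    have h1 := hdet3 x x
    rw [det_traceForm] at h1
    have hx := hv ⟨traceAlt x, traceAlt_mem x⟩
    set c := v ((pointIdeal (trivialChar Γ)).toCotangent ⟨traceAlt x, traceAlt_mem x⟩)
    have h2 := hmul2 hx (hJ1 (traceAlt_mem x)) hx
    have h3 : (c * c) • z ^ 2 ∈ J 3 := by
      have := sub_mem (hfour h1) h2
      rwa [sub_sub_cancel] at this
    have hc : c = 0 := by
      by_contra hc
      exact hz2 (hunsmul (mul_ne_zero hc hc) h3)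
    rwa [hc, zero_smul, sub_zero] at hx
  have hdet4 : (Matrix.of fun i j => traceForm (x i) (y j)).det ∈ J 4 := by
    rw [det_traceForm, mul_assoc]
    exact (J 4).mul_mem_left _ (hm (halt x) (halt y))
  set c : Fin 3 → Fin 3 → ℂ := fun i j => v ((pointIdeal (trivialChar Γ)).toCotangent
      ⟨traceForm (x i) (y j), traceForm_mem _ _⟩) with hc
  have h (i j k l p q : Fin 3) :
      traceForm (x i) (y j) * traceForm (x k) (y l) * traceForm (x p) (y q) -
        (c i j * c k l * c p q) • z ^ 3 ∈ J 4 :=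
    hmul3 (hv ⟨_, traceForm_mem _ _⟩) (hJ1 (traceForm_mem _ _)) (hv ⟨_, traceForm_mem _ _⟩)
      (hJ1 (traceForm_mem _ _)) (hv ⟨_, traceForm_mem _ _⟩)
  -- The leading term of the determinant is the determinant of the leading terms; since the left
  -- side has order at least four, that of `c` must vanish.
  have hcong : (Matrix.of fun i j => traceForm (x i) (y j)).det - (Matrix.of c).det • z ^ 3 ∈ J 4 := by
    have := sub_mem (add_mem (add_mem (sub_mem (sub_mem (h 0 0 1 1 2 2) (h 0 0 1 2 2 1))
      (h 0 1 1 0 2 2)) (h 0 1 1 2 2 0)) (h 0 2 1 0 2 1)) (h 0 2 1 1 2 0)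
    convert this using 1
    rw [Matrix.det_fin_three, Matrix.det_fin_three]
    simp only [Matrix.of_apply, Algebra.smul_def, map_sub, map_add, map_mul]
    ring
  by_contra hne
  refine hz3 (hunsmul hne ?_)
  have := sub_mem hdet4 hcong
  rwa [sub_sub_cancel] at this

lemma exists_linearIndependent_fin {V ι : Type*} [AddCommGroup V] [Module ℂ V]
    [FiniteDimensional ℂ V] {w : ι → V} (hw : Submodule.span ℂ (Set.range w) = ⊤) {k : ℕ}
    (hk : k ≤ Module.finrank ℂ V) : ∃ x : Fin k → ι, LinearIndependent ℂ (w ∘ x) := by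
  obtain ⟨f, hf, -, hli⟩ := Submodule.exists_fun_fin_finrank_span_eq ℂ (Set.range w)
  choose x hx using hf
  have hk' : k ≤ Module.finrank ℂ (Submodule.span ℂ (Set.range w)) := by rwa [hw, finrank_top]
  refine ⟨x ∘ Fin.castLE hk', ?_⟩
  rw [← Function.comp_assoc, show w ∘ x = f from funext hx]
  exact hli.comp _ (Fin.castLE_injective hk')

/-- If the homology has dimension at least three, some Gram determinant of order three of a
nondegenerate quadratic form does not vanish. -/
lemma exists_det_ne_zero [FiniteDimensional ℂ (H₁ Γ)] (hn : 2 < Module.finrank ℂ (H₁ Γ))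
    {q : QuadraticForm ℂ (H₁ Γ)} (hq : (QuadraticMap.associated q).Nondegenerate) :
    ∃ x y : Fin 3 → Γ, (Matrix.of fun i j =>
      q (homologyClass (x i * y j)) - q (homologyClass (x i * (y j)⁻¹))).det ≠ 0 := by
  set B := QuadraticMap.associated q with hB
  have hpol (x y : Γ) : q (homologyClass (x * y)) - q (homologyClass (x * y⁻¹)) =
      4 * B (homologyClass x) (homologyClass y) := by
    have h2 (X Y : H₁ Γ) : q (X + Y) = q X + q Y + 2 * B X Y := by
      rw [hB, QuadraticMap.associated_apply]
      simp
    rw [homologyClass_mul, homologyClass_mul, homologyClass_inv, h2, h2, QuadraticMap.map_neg,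
      map_neg]
    ring
  obtain ⟨x, hx⟩ := exists_linearIndependent_fin (span_homologyClass (Γ := Γ)) (k := 3) hn
  let Φ : H₁ Γ →ₗ[ℂ] (Fin 3 → ℂ) := LinearMap.pi fun i => B (homologyClass (x i))
  -- A linear relation among the components of `Φ` would put a nontrivial combination of the
  -- independent classes of the `x i` in the kernel of `B`. The images of the group elements then
  -- span `ℂ³`, and three independent ones provide the `y j`.
  have hΦ : LinearMap.range Φ = ⊤ := by
    by_contra hne
    obtain ⟨f, hf0, hf⟩ := Submodule.exists_le_ker_of_lt_top _ (lt_top_iff_ne_top.2 hne)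
    have hfe (u : Fin 3 → ℂ) : f u = ∑ i, u i * f (Pi.single i 1) := by
      conv_lhs => rw [pi_eq_sum_univ' u, map_sum]
      exact Finset.sum_congr rfl fun i _ => by rw [map_smul, smul_eq_mul]
    have hsum : ∑ i, f (Pi.single i 1) • homologyClass (x i) = 0 := by
      refine hq.1 _ fun Y => ?_
      have : f (Φ Y) = 0 := hf ⟨Y, rfl⟩
      rw [hfe] at this
      rw [map_sum, LinearMap.sum_apply, ← this]
      refine Finset.sum_congr rfl fun i _ => ?_
      rw [map_smul, LinearMap.smul_apply, smul_eq_mul, mul_comm]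
      rfl
    have := Fintype.linearIndependent_iff.1 hx _ hsum
    exact hf0 (LinearMap.ext fun u => by simp [hfe u, this])
  have hspan : Submodule.span ℂ (Set.range fun γ : Γ => Φ (homologyClass γ)) = ⊤ := by
    rw [← hΦ, ← Submodule.map_top, ← span_homologyClass, Submodule.map_span, ← Set.range_comp]
    rfl
  obtain ⟨y, hy⟩ := exists_linearIndependent_fin hspan (k := 3) (by simp)
  refine ⟨x, y, ?_⟩
  have hM : (Matrix.of fun i j => q (homologyClass (x i * y j)) -
      q (homologyClass (x i * (y j)⁻¹))) =
      (4 : ℂ) • (Matrix.of fun j => Φ (homologyClass (y j))).transpose := by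
    ext i j
    simp only [Matrix.of_apply, hpol, Matrix.smul_apply, Matrix.transpose_apply, smul_eq_mul]
    rfl
  have hu : IsUnit (Matrix.of fun j => Φ (homologyClass (y j))) :=
    Matrix.linearIndependent_rows_iff_isUnit.1 hy
  rw [hM, Matrix.det_smul, Matrix.det_transpose]
  exact mul_ne_zero (by norm_num) ((Matrix.isUnit_iff_isUnit_det _).1 hu).ne_zero

/-- A tangent vector given by a form of rank at least three is not compatible with a filtration in
which it becomes a parameter of a smooth curve. -/
lemma false_of_filtration [FiniteDimensional ℂ (H₁ Γ)] (hn : 2 < Module.finrank ℂ (H₁ Γ))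
    {q : QuadraticForm ℂ (H₁ Γ)} (hq : (QuadraticMap.associated q).Nondegenerate)
    {v : TangentSpace (trivialChar Γ)}
    (hvq : ∀ γ : Γ, v ((pointIdeal (trivialChar Γ)).toCotangent (uFn γ)) = q (homologyClass γ))
    {J : ℕ → Ideal (charRing Γ)}
    (hJmul : ∀ a b, J a * J b ≤ J (a + b)) (hJ1 : pointIdeal (trivialChar Γ) ≤ J 1)
    {z : charRing Γ} (hz : z ∈ J 1)
    (hv : ∀ a : pointIdeal (trivialChar Γ),
      (a : charRing Γ) - v ((pointIdeal (trivialChar Γ)).toCotangent a) • z ∈ J 2)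
    (hzk : ∀ k, z ^ k ∉ J (k + 1)) : False := by
  obtain ⟨x, y, hdet⟩ := exists_det_ne_zero hn hq
  have := det_eq_zero_of_filtration hJmul hJ1 hz hv (hzk 2) (hzk 3) x y
  simp only [tangent_traceForm, hvq] at this
  exact hdet this

/-- A nonvanishing Gram determinant forces `v ≠ 0`. -/
lemma exists_parameter [FiniteDimensional ℂ (H₁ Γ)] (hn : 2 < Module.finrank ℂ (H₁ Γ))
    {q : QuadraticForm ℂ (H₁ Γ)} (hq : (QuadraticMap.associated q).Nondegenerate)
    {v : TangentSpace (trivialChar Γ)}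
    (hvq : ∀ γ : Γ, v ((pointIdeal (trivialChar Γ)).toCotangent (uFn γ)) = q (homologyClass γ)) :
    ∃ z : pointIdeal (trivialChar Γ), v ((pointIdeal (trivialChar Γ)).toCotangent z) = 1 := by
  have hv0 : v ≠ 0 := by
    rintro rfl
    obtain ⟨x, y, hdet⟩ := exists_det_ne_zero hn hq
    simp only [← hvq] at hdet
    simp [Matrix.det_fin_three] at hdet
  obtain ⟨c, hc⟩ := LinearMap.surjective hv0 1
  obtain ⟨z, rfl⟩ := (pointIdeal (trivialChar Γ)).toCotangent_surjective c
  exact ⟨z, hc⟩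

lemma not_isUnobstructed [FiniteDimensional ℂ (H₁ Γ)] (hn : 2 < Module.finrank ℂ (H₁ Γ))
    {q : QuadraticForm ℂ (H₁ Γ)} (hq : (QuadraticMap.associated q).Nondegenerate)
    {v : TangentSpace (trivialChar Γ)}
    (hvq : ∀ γ : Γ, v ((pointIdeal (trivialChar Γ)).toCotangent (uFn γ)) = q (homologyClass γ)) :
    ¬ IsUnobstructed v := by
  rintro ⟨F, hF⟩
  obtain ⟨z, hz⟩ := exists_parameter hn hq hvq
  -- The filtration by order in `t` along the deformation.
  let J : ℕ → Ideal (charRing Γ) := fun k => (Ideal.span {(PowerSeries.X : PowerSeries ℂ) ^ k}).comap F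
  have hJ {k : ℕ} {s : charRing Γ} : s ∈ J k ↔ (PowerSeries.X : PowerSeries ℂ) ^ k ∣ F s := by
    rw [Ideal.mem_comap, Ideal.mem_span_singleton]
  have hJ1 (a : pointIdeal (trivialChar Γ)) : (a : charRing Γ) ∈ J 1 := by
    rw [hJ, PowerSeries.X_pow_dvd_iff]
    intro m hm
    obtain rfl : m = 0 := by omega
    exact (hF a).1
  refine false_of_filtration hn hq hvq (J := J) ?_ (fun a ha => hJ1 ⟨a, ha⟩) (hJ1 z) ?_ ?_
  · intro a b
    rw [Ideal.mul_le]
    intro s hs t ht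
    rw [hJ] at hs ht ⊢
    rw [map_mul, pow_add]
    exact mul_dvd_mul hs ht
  · intro a
    rw [hJ, PowerSeries.X_pow_dvd_iff]
    intro m hm
    rw [map_sub, map_smul, map_sub, PowerSeries.coeff_smul]
    interval_cases m
    · rw [(hF a).1, (hF z).1, smul_zero, sub_zero]
    · rw [(hF a).2, (hF z).2, hz, smul_eq_mul, mul_one, sub_self]
  · intro k hk
    -- `F z` is `t` times a series with constant term `v(z) = 1`, so `F (z ^ k)` has order exactly
    -- `k`.
    obtain ⟨g, hg⟩ := hJ.1 (hJ1 z)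
    rw [pow_one] at hg
    have hg1 : PowerSeries.constantCoeff g = 1 := by
      have := (hF z).2
      rw [hz, hg, PowerSeries.coeff_succ_X_mul 0] at this
      simpa using this
    rw [hJ, map_pow, hg, mul_pow, pow_succ,
      mul_dvd_mul_iff_left (pow_ne_zero _ PowerSeries.X_ne_zero), PowerSeries.X_dvd_iff, map_pow,
      hg1, one_pow] at hk
    exact one_ne_zero hk

lemma not_isSmoothAt [Group.FG Γ] [FiniteDimensional ℂ (H₁ Γ)]
    (hn : 2 < Module.finrank ℂ (H₁ Γ))
    {q : QuadraticForm ℂ (H₁ Γ)} (hq : (QuadraticMap.associated q).Nondegenerate) :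
    ¬ IsSmoothAt (trivialChar Γ) := by
  intro hs
  obtain ⟨v, hvq⟩ := exists_tangent_quadraticForm q
  obtain ⟨z, hz⟩ := exists_parameter hn hq hvq
  obtain ⟨J, hJmul, hJ1, hv, hzk⟩ := exists_filtration_of_isSmoothAt hs hz
  exact false_of_filtration hn hq hvq hJmul hJ1 (hJ1 z.2) hv hzk

lemma exists_nondegenerate (V : Type*) [AddCommGroup V] [Module ℂ V] [FiniteDimensional ℂ V] :
    ∃ q : QuadraticForm ℂ V, (QuadraticMap.associated q).Nondegenerate := by
  let b := Module.finBasis ℂ V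
  -- The sum of the squares of the coordinates.
  refine ⟨∑ i, QuadraticMap.linMulLin (b.coord i) (b.coord i), ?_⟩
  have h (x : V) (i) : QuadraticMap.associated
      (∑ i, QuadraticMap.linMulLin (b.coord i) (b.coord i)) x (b i) = b.coord i x := by
    rw [QuadraticMap.associated_apply]
    simp [add_mul, mul_add, Finset.sum_add_distrib, Finsupp.single_apply]
    ring
  have hsymm (x y : V) : QuadraticMap.associated
      (∑ i, QuadraticMap.linMulLin (b.coord i) (b.coord i)) x y = QuadraticMap.associated
      (∑ i, QuadraticMap.linMulLin (b.coord i) (b.coord i)) y x := by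
    rw [QuadraticMap.associated_apply, QuadraticMap.associated_apply, add_comm x y, sub_right_comm]
  have h0 (x : V) (hx : ∀ i, b.coord i x = 0) : x = 0 := b.forall_coord_eq_zero_iff.1 hx
  refine ⟨fun x hx => h0 x fun i => ?_, fun x hx => h0 x fun i => ?_⟩
  · rw [← h, hx]
  · rw [← h, hsymm, hx]

end LargeHomology

end CharVar

end

theorem mainTheorem5 (Γ : Type) [Group Γ] [Group.FG Γ] (n : ℕ)
    (hn : Module.finrank ℂ (CharVar.H₁ Γ) = n) :
    (n < 2 → CharVar.IsSmoothAt (CharVar.trivialChar Γ)) ∧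
    (2 < n →
      ¬ CharVar.IsSmoothAt (CharVar.trivialChar Γ) ∧
      ∀ q : QuadraticForm ℂ (CharVar.H₁ Γ), (QuadraticMap.associated q).Nondegenerate →
        ∃ v : CharVar.TangentSpace (CharVar.trivialChar Γ),
          (∀ γ : Γ,
            v ((CharVar.pointIdeal (CharVar.trivialChar Γ)).toCotangent (CharVar.uFn γ)) =
              q (CharVar.homologyClass γ)) ∧
          ¬ CharVar.IsUnobstructed v) := by
  subst hn
  have := CharVar.finite_H₁ Γ
  refine ⟨fun h => ?_, fun h => ⟨?_, fun q hq => ?_⟩⟩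
  · interval_cases hn : Module.finrank ℂ (CharVar.H₁ Γ)
    · exact CharVar.isSmoothAt_of_finrank_eq_zero hn
    · exact CharVar.isSmoothAt_of_finrank_eq_one hn
  · obtain ⟨q, hq⟩ := CharVar.exists_nondegenerate (CharVar.H₁ Γ)
    exact CharVar.not_isSmoothAt h hq
  · obtain ⟨v, hv⟩ := CharVar.exists_tangent_quadraticForm q
    exact ⟨v, hv, CharVar.not_isUnobstructed h hq hv⟩
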